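/- Let $(\Omega,\mathcal F,\mathbb P)$ be a non-atomic probability space (every measurable set of positive probability has a measurable subset of strictly smaller positive probability), and let $L^0$ be the space of real random variables on it modulo a.s. equality. Write $X\sim Y$ if $X$ and $Y$ have the same distribution. Let $\mathcal X\neq\{0\}$ be a rearrangement-invariant space over $\Omega$: a linear subspace of $L^0$ with a complete norm such that for every $X\in\mathcal X$, (i) if $Y\in L^0$ and $|Y|\le|X|$ a.s., then $Y\in\mathcal X$ and $\|Y\|\le\|X\|$; (ii) if $Z\in L^0$ and $Z\sim X$, then $Z\in\mathcal X$ and $\|Z\|=\|X\|$. Put $\mathcal X_+=\{X\in\mathcal X: X\ge 0\}$ and $\mathcal X_a=\{X\in\mathcal X:\lim_{\mathbb P(A)\to0}\|X\mathbf 1_A\|=0\}$. The space $\mathcal X$ is order continuous if $\mathcal X_a=\mathcal X$, and monotonically complete if the pointwise supremum of every increasing, norm bounded sequence in $\mathcal X_+$ belongs to $\mathcal X$. For measurable sets, $A_n\downarrow\emptyset$ means that $(A_n)$ is decreasing with empty intersection. Consider the following conditions. (AOCEA) For every $X\in\mathcal X_+$, the norm distance between $\mathrm{co}\{Y:Y\sim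 X\}$ (the convex hull) and $\mathcal X_a$ is $0$. (3.2) For every $X\in\mathcal X_+$, every $\varepsilon>0$ and every sequence of measurable sets $A_n\downarrow\emptyset$, there exist natural numbers $n_1,\dots,n_k$, random variables $Z_1,\dots,Z_k$ with $Z_i\sim X\mathbf 1_{A_{n_i}}$ for $i=1,\dots,k$, and a convex combination $\sum_{i=1}^k\lambda_iZ_i$ with $\big\|\sum_{i=1}^k\lambda_iZ_i\big\|<\varepsilon$. (3.3) For every $X\in\mathcal X$, every $\varepsilon>0$, every sequence of measurable sets $A_n\downarrow\emptyset$ with $\sum_{n=1}^\infty\mathbb P(A_n)\le1$, and every sequence $(Z_n)_{n\ge1}$ of pairwise disjoint random variables (that is, $Z_mZ_n=0$ a.s. for $m\ne n$) with $Z_n\sim X\mathbf 1_{A_n}$ for all $n$, there exist $k\ge1$ and $n_1,\dots,n_k\in\mathbb N$ such that $\big\|\frac1k\sum_{i=1}^kZ_{n_i}\big\|<\varepsilon$. Suppose that $\mathcal X\ne L^\infty$. Then (3.3) implies (3.2), and (3.2) is equivalent to (AOCEA). Conversely, if $\mathcal X$ is monotonically complete or order continuous, then (3.2) implies (3.3),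 and the indices $n_1,\dots,n_k$ in (3.3) can moreover be taken pairwise distinct. -/

import Mathlib

open MeasureTheory ProbabilityTheory Filter Topology Set
open scoped ENNReal

/-- A measure is non-atomic if every measurable set of positive measure splits: it has a measurable
subset of strictly smaller positive measure. (Mathlib's `NoAtoms`-type classes only say that
singletons are null, which is a weaker property in general.) -/
def IsNonAtomic {Ω : Type*} [MeasurableSpace Ω] (P : Measure Ω) : Prop :=
  ∀ A : Set Ω, MeasurableSet A → 0 < P A →
    ∃ B : Set Ω, MeasurableSet B ∧ B ⊆ A ∧ 0 < P B ∧ P B < P A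

/-- The random variable `X 𝟙_A`. -/
noncomputable def restrictTo {Ω : Type*} [MeasurableSpace Ω] {P : Measure Ω}
    (X : Ω →ₘ[P] ℝ) {A : Set Ω} (hA : MeasurableSet A) : Ω →ₘ[P] ℝ :=
  AEEqFun.mk (A.indicator X) (X.aestronglyMeasurable.indicator hA)

theorem abs_restrictTo_le {Ω : Type*} [MeasurableSpace Ω] {P : Measure Ω}
    (X : Ω →ₘ[P] ℝ) {A : Set Ω} (hA : MeasurableSet A) : |restrictTo X hA| ≤ |X| := by
  rw [← AEEqFun.coeFn_le]
  filter_upwards [AEEqFun.coeFn_abs (restrictTo X hA), AEEqFun.coeFn_abs X,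
    AEEqFun.coeFn_mk (A.indicator X) (X.aestronglyMeasurable.indicator hA)] with ω h1 h2 h3
  rw [h1, h2, restrictTo, h3]
  by_cases h : ω ∈ A
  · rw [indicator_of_mem h]
  · rw [indicator_of_notMem h, abs_zero]
    exact abs_nonneg _

/-- `X ∼ Y`: the random variables `X` and `Y` have the same distribution. -/
def SameLaw {Ω : Type*} [MeasurableSpace Ω] {P : Measure Ω} (X Y : Ω →ₘ[P] ℝ) : Prop :=
  IdentDistrib X Y P P

/-- A rearrangement-invariant space over `(Ω, P)`: a nonzero linear subspace of `L⁰`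
(random variables modulo a.s. equality) with a complete norm, which is solid and law invariant. -/
structure RISpace {Ω : Type*} [MeasurableSpace Ω] (P : Measure Ω) where
  /-- The underlying linear subspace of `L⁰`. -/
  space : Submodule ℝ (Ω →ₘ[P] ℝ)
  /-- The norm. -/
  norm : Seminorm ℝ space
  space_ne_bot : space ≠ ⊥
  eq_zero_of_norm_eq_zero : ∀ X : space, norm X = 0 → X = 0
  complete : ∀ X : ℕ → space,
    (∀ ε : ℝ, 0 < ε → ∃ N : ℕ, ∀ m ≥ N, ∀ n ≥ N, norm (X m - X n) < ε) →
    ∃ Y : space, Tendsto (fun n => norm (X n - Y)) atTop (𝓝 0)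
  solid : ∀ (X : space) (Y : Ω →ₘ[P] ℝ), |Y| ≤ |(X : Ω →ₘ[P] ℝ)| →
    ∃ hY : Y ∈ space, norm ⟨Y, hY⟩ ≤ norm X
  lawInvariant : ∀ (X : space) (Z : Ω →ₘ[P] ℝ), SameLaw Z (X : Ω →ₘ[P] ℝ) →
    ∃ hZ : Z ∈ space, norm ⟨Z, hZ⟩ = norm X

namespace RISpace

variable {Ω : Type*} [MeasurableSpace Ω] {P : Measure Ω} (E : RISpace P)

/-- `X 𝟙_A` as an element of the r.i. space. -/
noncomputable def cut (X : E.space) {A : Set Ω} (hA : MeasurableSet A) : E.space :=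
  ⟨restrictTo (X : Ω →ₘ[P] ℝ) hA, (E.solid X _ (abs_restrictTo_le _ hA)).1⟩

/-- The order continuous part: all `X` in the space with `‖X 𝟙_A‖ → 0` as `P(A) → 0`. -/
def orderContinuousPart : Set E.space :=
  {X | ∀ ε : ℝ, 0 < ε → ∃ δ : ℝ, 0 < δ ∧
    ∀ (A : Set Ω) (hA : MeasurableSet A), P.real A < δ → E.norm (E.cut X hA) < ε}

/-- The space is order continuous if it equals its order continuous part. -/
def IsOrderContinuous : Prop := E.orderContinuousPart = Set.univ

/-- The space is monotonically complete if the pointwise supremum of any increasing, norm bounded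
sequence of nonnegative elements belongs to the space. -/
def IsMonotonicallyComplete : Prop :=
  ∀ X : ℕ → E.space, (∀ n, 0 ≤ (X n : Ω →ₘ[P] ℝ)) → Monotone (fun n => (X n : Ω →ₘ[P] ℝ)) →
    (∃ C : ℝ, ∀ n, E.norm (X n) ≤ C) →
    ∃ Y : E.space, ∀ᵐ ω ∂P,
      IsLUB (Set.range fun n => (X n : Ω →ₘ[P] ℝ) ω) ((Y : Ω →ₘ[P] ℝ) ω)

/-- The convex hull of the set of all random variables with the same distribution as `X`
(they all belong to the space, by law invariance). -/
def lawHull (X : E.space) : Set E.space :=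
  convexHull ℝ {Y : E.space | SameLaw (Y : Ω →ₘ[P] ℝ) (X : Ω →ₘ[P] ℝ)}

/-- The Almost Order Continuous Equidistributional Average property: for every `X ≥ 0` the norm
distance (the infimum of all `‖Y - V‖`) from `lawHull X` to the order continuous part is zero. -/
def AOCEA : Prop :=
  ∀ X : E.space, 0 ≤ (X : Ω →ₘ[P] ℝ) →
    IsGLB {r : ℝ | ∃ Y ∈ E.lawHull X, ∃ V ∈ E.orderContinuousPart, r = E.norm (Y - V)} 0

/-- The convex combination condition: for `X ≥ 0`, `ε > 0` and measurable `A n ↓ ∅` there are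
indices `n 1, …, n k`, random variables `Z i ∼ X 𝟙_{A (n i)}` and a convex combination of the
`Z i` of norm `< ε`. -/
def ConvexAveraging : Prop :=
  ∀ X : E.space, 0 ≤ (X : Ω →ₘ[P] ℝ) → ∀ ε : ℝ, 0 < ε →
    ∀ (A : ℕ → Set Ω) (hA : ∀ n, MeasurableSet (A n)), Antitone A → (⋂ n, A n) = ∅ →
    ∃ (k : ℕ) (n : Fin k → ℕ) (Z : Fin k → E.space) (c : Fin k → ℝ),
      (∀ i, SameLaw (Z i : Ω →ₘ[P] ℝ) (E.cut X (hA (n i)) : Ω →ₘ[P] ℝ)) ∧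
      (∀ i, 0 ≤ c i) ∧ ∑ i, c i = 1 ∧
      E.norm (∑ i, c i • Z i) < ε

/-- The disjoint averaging condition: for `X`, `ε > 0`, measurable `A n ↓ ∅` with
`∑ P(A n) ≤ 1` and disjoint `Z n ∼ X 𝟙_{A n}` (which belong to the space, by law invariance),
some average `(1/k) (Z (n 1) + ⋯ + Z (n k))` has norm `< ε`. The indices may repeat. -/
def DisjointAveraging : Prop :=
  ∀ X : E.space, ∀ ε : ℝ, 0 < ε →
    ∀ (A : ℕ → Set Ω) (hA : ∀ n, MeasurableSet (A n)), Antitone A → (⋂ n, A n) = ∅ →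
    ∑' n, P (A n) ≤ 1 →
    ∀ Z : ℕ → E.space,
      (∀ i j, i ≠ j → ∀ᵐ ω ∂P, (Z i : Ω →ₘ[P] ℝ) ω = 0 ∨ (Z j : Ω →ₘ[P] ℝ) ω = 0) →
      (∀ n, SameLaw (Z n : Ω →ₘ[P] ℝ) (E.cut X (hA n) : Ω →ₘ[P] ℝ)) →
      ∃ (k : ℕ) (n : Fin k → ℕ), 0 < k ∧
        E.norm ((1 / (k : ℝ)) • ∑ i, Z (n i)) < ε

/-- The disjoint averaging condition in the formally stronger form in which the indices
`n 1, …, n k` have to be pairwise distinct, so that the average is one of disjoint functions. -/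
def DisjointAveragingDistinct : Prop :=
  ∀ X : E.space, ∀ ε : ℝ, 0 < ε →
    ∀ (A : ℕ → Set Ω) (hA : ∀ n, MeasurableSet (A n)), Antitone A → (⋂ n, A n) = ∅ →
    ∑' n, P (A n) ≤ 1 →
    ∀ Z : ℕ → E.space,
      (∀ i j, i ≠ j → ∀ᵐ ω ∂P, (Z i : Ω →ₘ[P] ℝ) ω = 0 ∨ (Z j : Ω →ₘ[P] ℝ) ω = 0) →
      (∀ n, SameLaw (Z n : Ω →ₘ[P] ℝ) (E.cut X (hA n) : Ω →ₘ[P] ℝ)) →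
      ∃ (k : ℕ) (n : Fin k → ℕ), 0 < k ∧ Function.Injective n ∧
        E.norm ((1 / (k : ℝ)) • ∑ i, Z (n i)) < ε

end RISpace

/-! ### Sets of every measure and uniform variables on a non-atomic space -/

section NonAtomic

variable {Ω : Type*} [MeasurableSpace Ω] {P : Measure Ω}

/-! The basic tool is rearrangement. On a non-atomic space every random variable is a.s. `q(U)` with
`q` its quantile function and `U` uniform (`IsNonAtomic.exists_eq_quantile_comp`). Inserting the
same `U` into another quantile function turns comparisons into pointwise ones: if `V ≤ W` and `Y ∼
W`, some copy of `V` lies below `Y`; if `W ≤ X ≤ W + m`, some copy of `X` lies within `m` of any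
given copy of `W`.

`ConvexAveraging` gives `AOCEA` by taking `A n = {X > n}`: copies of these tails extend to copies of
`X` with a bounded error, and bounded elements are order continuous because the space is not `L^∞`
(`mem_orderContinuousPart_of_bounded`). Conversely, let a convex combination of copies of `X` be
close to an order continuous `V`. Each copy dominates a copy of `X 𝟙_{A n}` carried by a set of
measure `P (A n)`. The union of these sets is small, so `V` is negligible there and the distance to
`V` controls the rest. `DisjointAveraging` gives `ConvexAveraging` by thinning out `A` and building
disjoint copies.

The remaining direction rests on `gauge_disjoint_sum_le`: among sums of nonnegative functions with
prescribed laws, a disjoint one has the least norm. To see this, let `S` be the sum of the `f j` and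
cut `[0, S)` into consecutive intervals of lengths `f j`. The level `v S / K` falls into one
interval and so selects one `j`. Placing the value `S` on the `j`-th disjoint piece whenever `j` is
selected gives a copy of `S`. The average of these copies over `v < K` dominates the disjoint sum up
to an error `S / K` on each piece, and `K → ∞`. With this inequality, a convex combination of small
norm is turned into a sum with equal weights and then into a disjoint sum with distinct, larger
indices. -/

theorem measure_le_of_sdiff_null {A B : Set Ω} (h : P (A \ B) = 0) : P A ≤ P B :=
  measure_mono_ae (ae_le_set.2 h)

theorem measure_sdiff_null_of_measure_le [IsFiniteMeasure P] {A B : Set Ω} (hB : MeasurableSet B)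
    (h : P (B \ A) = 0) (hAB : P A ≤ P B) : P (A \ B) = 0 :=
  ae_le_set.1 (ae_eq_of_ae_subset_of_measure_ge (ae_le_set.2 h) hAB hB.nullMeasurableSet
    (measure_ne_top _ _)).symm.le

theorem measure_sdiff_null_of_total [IsFiniteMeasure P] {C D : Set Ω} (hD : MeasurableSet D)
    (htot : P (C \ D) = 0 ∨ P (D \ C) = 0) (h : P C ≤ P D) : P (C \ D) = 0 :=
  htot.elim id fun h' => measure_sdiff_null_of_measure_le hD h' h

/-- In a family of measurable sets which is totally ordered by almost sure inclusion, the members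
of measure at most `t` have a countable union as essential upper bound. -/
theorem exists_iUnion_essential_bound [IsFiniteMeasure P] {M : Set (Set Ω)}
    (hmeas : ∀ C ∈ M, MeasurableSet C)
    (htot : ∀ C ∈ M, ∀ D ∈ M, P (C \ D) = 0 ∨ P (D \ C) = 0) {t : ℝ≥0∞}
    (h0 : ∃ C ∈ M, P C ≤ t) :
    ∃ C : ℕ → Set Ω, (∀ n, C n ∈ M ∧ P (C n) ≤ t) ∧ P (⋃ n, C n) ≤ t ∧
      ∀ D ∈ M, P D ≤ t → P (D \ ⋃ n, C n) = 0 := by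
  obtain ⟨C0, hC0, hC0t⟩ := h0
  obtain ⟨u, hu, hlim, hmem⟩ := exists_seq_tendsto_sSup (S := P '' {C | C ∈ M ∧ P C ≤ t})
    ⟨_, C0, ⟨hC0, hC0t⟩, rfl⟩ (OrderTop.bddAbove _)
  choose C hC hCu using hmem
  have hmono : ∀ m n, m ≤ n → P (C m \ C n) = 0 := fun m n hmn =>
    measure_sdiff_null_of_total (hmeas _ (hC n).1) (htot _ (hC m).1 _ (hC n).1)
      (by rw [hCu, hCu]; exact hu hmn)
  refine ⟨C, hC, ?_, fun D hD hDt => ?_⟩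
  · rw [measure_iUnion_eq_iSup_accumulate]
    refine iSup_le fun n => le_trans (measure_le_of_sdiff_null (B := C n) ?_) (hC n).2
    have hsub : accumulate C n \ C n ⊆ ⋃ m ∈ Iic n, C m \ C n := by
      rintro x ⟨hx, hxn⟩
      obtain ⟨m, hm, hxm⟩ := mem_accumulate.1 hx
      exact mem_biUnion (mem_Iic.2 hm) ⟨hxm, hxn⟩
    exact measure_mono_null hsub
      ((measure_biUnion_null_iff (to_countable _)).2 fun m hm => hmono m n hm)
  · by_cases hex : ∃ n, P D ≤ P (C n)
    · obtain ⟨n, hn⟩ := hex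
      exact measure_mono_null (sdiff_subset_sdiff_right (subset_iUnion C n))
        (measure_sdiff_null_of_total (hmeas _ (hC n).1) (htot _ hD _ (hC n).1) hn)
    -- Now `D` a.s. contains every `C n`, while its measure is at most the supremum, which the union
    -- attains; so `D` is a.s. the union.
    · push Not at hex
      refine measure_sdiff_null_of_measure_le (MeasurableSet.iUnion fun n => hmeas _ (hC n).1) ?_ ?_
      · rw [iUnion_sdiff]
        exact measure_iUnion_null fun n => measure_sdiff_null_of_total (hmeas _ hD)
          (htot _ (hC n).1 _ hD) (hex n).le
      · calc P D ≤ sSup (P '' {C | C ∈ M ∧ P C ≤ t}) := le_sSup ⟨D, ⟨hD, hDt⟩, rfl⟩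
          _ ≤ P (⋃ n, C n) := le_of_tendsto' hlim fun n => by
            rw [← hCu n]; exact measure_mono (subset_iUnion C n)

/-- A maximal chain of measurable sets of a non-atomic probability space attains every measure. -/
theorem IsNonAtomic.exists_mem_chain_measure_eq [IsProbabilityMeasure P] (hP : IsNonAtomic P)
    {M : Set (Set Ω)} (hmeas : ∀ C ∈ M, MeasurableSet C)
    (htot : ∀ C ∈ M, ∀ D ∈ M, P (C \ D) = 0 ∨ P (D \ C) = 0)
    (hmax : ∀ D, MeasurableSet D → (∀ C ∈ M, P (C \ D) = 0 ∨ P (D \ C) = 0) → D ∈ M)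
    {t : ℝ≥0∞} (ht : t ≤ 1) : ∃ C ∈ M, P C = t := by
  have hempty : ∅ ∈ M := hmax ∅ MeasurableSet.empty fun C _ => Or.inr (by simp)
  have huniv : univ ∈ M := hmax univ MeasurableSet.univ fun C _ => Or.inl (by simp)
  have hcompl : ∀ C D : Set Ω, Cᶜ \ Dᶜ = D \ C := fun C D => by ext; simp [and_comm]
  obtain ⟨C, hC, hCt, hCD⟩ := exists_iUnion_essential_bound (t := t) hmeas htot ⟨∅, hempty, by simp⟩
  -- Passing to complements yields the dual bound: `V` below is an essential lower bound of the
  -- members of measure at least `t`.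
  obtain ⟨E, hE, hEt, hED⟩ := exists_iUnion_essential_bound (P := P) (M := compl '' M) (t := 1 - t)
    (by rintro _ ⟨C, hC, rfl⟩; exact (hmeas C hC).compl)
    (by
      rintro _ ⟨C, hC, rfl⟩ _ ⟨D, hD, rfl⟩
      rw [hcompl, hcompl]
      exact (htot C hC D hD).symm)
    ⟨∅, ⟨univ, huniv, by simp⟩, by simp⟩
  set L := ⋃ n, C n with hL
  set V := (⋃ n, E n)ᶜ with hV
  have hLm : MeasurableSet L := MeasurableSet.iUnion fun n => hmeas _ (hC n).1
  have hEm : MeasurableSet (⋃ n, E n) := MeasurableSet.iUnion fun n => by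
    obtain ⟨D, hD, hDE⟩ := (hE n).1
    rw [← hDE]; exact (hmeas D hD).compl
  have hcompl_le : ∀ D : Set Ω, MeasurableSet D → (P Dᶜ ≤ 1 - t ↔ t ≤ P D) := fun D hD => by
    rw [prob_compl_eq_one_sub hD]
    exact ENNReal.sub_le_sub_iff_left ht ENNReal.one_ne_top
  have hVt : t ≤ P V := by
    rw [← hcompl_le V hEm.compl, hV, compl_compl]
    exact hEt
  have hVD : ∀ D ∈ M, t ≤ P D → P (V \ D) = 0 := fun D hD hDt => by
    have := hED Dᶜ ⟨D, hD, rfl⟩ ((hcompl_le D (hmeas D hD)).2 hDt)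
    rwa [← hcompl, hV, compl_compl]
  have hLD : ∀ D ∈ M, t ≤ P D → P (L \ D) = 0 := fun D hD hDt => by
    rw [hL, iUnion_sdiff]
    exact measure_iUnion_null fun n => measure_sdiff_null_of_total (hmeas _ hD)
      (htot _ (hC n).1 _ hD) ((hC n).2.trans hDt)
  by_cases hLt : P L = t
  · refine ⟨L, hmax L hLm fun D hD => ?_, hLt⟩
    rcases le_total (P D) t with h | h
    · exact Or.inl (hCD D hD h)
    · exact Or.inr (hLD D hD h)
  exfalso
  have hlt : P L < P V := (lt_of_le_of_ne hCt hLt).trans_le hVt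
  have hpos : 0 < P (V \ L) := by
    rw [pos_iff_ne_zero]
    exact fun h => absurd (measure_le_of_sdiff_null h) (not_le.2 hlt)
  -- A proper piece `B` of the gap gives a set `L ∪ B` comparable with the whole chain, hence in it,
  -- yet strictly between `L` and `V`; this contradicts one of the two bounds.
  obtain ⟨B, hBm, hBV, hB0, hB1⟩ := hP _ (hEm.compl.diff hLm) hpos
  have hDm : MeasurableSet (L ∪ B) := hLm.union hBm
  have hDM : L ∪ B ∈ M := by
    refine hmax _ hDm fun D hD => ?_
    rcases le_total (P D) t with h | h
    · exact Or.inl (measure_mono_null (sdiff_subset_sdiff_right subset_union_left) (hCD D hD h))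
    · refine Or.inr ?_
      rw [union_sdiff_distrib]
      exact measure_union_null (hLD D hD h)
        (measure_mono_null (sdiff_subset_sdiff_left (hBV.trans sdiff_subset)) (hVD D hD h))
  rcases le_total (P (L ∪ B)) t with h | h
  · have h1 := hCD _ hDM h
    refine hB0.ne' (measure_mono_null ?_ h1)
    exact fun x hx => ⟨Or.inr hx, (hBV hx).2⟩
  · have h1 := hVD _ hDM h
    have h2 : P ((V \ L) \ B) = 0 := by rwa [sdiff_sdiff]
    exact absurd (measure_le_of_sdiff_null h2) (not_le.2 hB1)

/-- Every random variable on a non-atomic probability space has its level sets interpolated by an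
increasing family of sets of prescribed measures. -/
theorem IsNonAtomic.exists_refining_chain [IsProbabilityMeasure P] (hP : IsNonAtomic P)
    {Y : Ω → ℝ} (hY : Measurable Y) :
    ∃ C : unitInterval → Set Ω, (∀ t, MeasurableSet (C t)) ∧
      (∀ t, P (C t) = ENNReal.ofReal t) ∧ (∀ s t, s ≤ t → P (C s \ C t) = 0) ∧
      (∀ (t : unitInterval) (c : ℝ), ENNReal.ofReal t ≤ P {ω | Y ω ≤ c} → P (C t \ {ω | Y ω ≤ c}) = 0) ∧
      (∀ (t : unitInterval) (c : ℝ), P {ω | Y ω ≤ c} ≤ ENNReal.ofReal t → P ({ω | Y ω ≤ c} \ C t) = 0) := by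
  let r : {A : Set Ω // MeasurableSet A} → {A : Set Ω // MeasurableSet A} → Prop :=
    fun A B => P (A.1 \ B.1) = 0
  have hlev : ∀ c, MeasurableSet {ω | Y ω ≤ c} := fun c => hY measurableSet_Iic
  have hchain : IsChain r (range fun c : ℝ => (⟨{ω | Y ω ≤ c}, hlev c⟩ : {A // MeasurableSet A})) := by
    rintro _ ⟨c, rfl⟩ _ ⟨d, rfl⟩ -
    have key : ∀ c d : ℝ, c ≤ d → P ({ω | Y ω ≤ c} \ {ω | Y ω ≤ d}) = 0 := fun c d h => by
      have hs : {ω | Y ω ≤ c} ⊆ {ω | Y ω ≤ d} := fun ω hω => le_trans hω h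
      rw [sdiff_eq_empty.2 hs, measure_empty]
    exact (le_total c d).imp (key c d) (key d c)
  obtain ⟨M, hM, hsub⟩ := hchain.exists_maxChain
  have hrefl : Std.Refl r := ⟨fun A => by simp [r]⟩
  have htot' : ∀ C ∈ Subtype.val '' M, ∀ D ∈ Subtype.val '' M,
      P (C \ D) = 0 ∨ P (D \ C) = 0 := by
    rintro _ ⟨C, hC, rfl⟩ _ ⟨D, hD, rfl⟩
    exact hM.1.total hC hD
  have hmeas' : ∀ C ∈ Subtype.val '' M, MeasurableSet C := by
    rintro _ ⟨C, hC, rfl⟩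
    exact C.2
  have hex : ∀ t : unitInterval, ∃ C ∈ Subtype.val '' M, P C = ENNReal.ofReal t := fun t => by
    refine hP.exists_mem_chain_measure_eq hmeas' htot' (fun D hD hcomp => ?_)
      (ENNReal.ofReal_le_one.2 t.2.2)
    refine ⟨⟨D, hD⟩, ?_, rfl⟩
    -- Maximality identifies `M` with `M` enlarged by `D`.
    rw [hM.2 (hM.1.insert (a := ⟨D, hD⟩) fun b hb _ => ?_) (subset_insert _ _)]
    · exact mem_insert _ _
    · exact (hcomp b ⟨b, hb, rfl⟩).symm
  choose C hCM hCP using hex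
  have hlevM : ∀ c, {ω | Y ω ≤ c} ∈ Subtype.val '' M := fun c => ⟨_, hsub ⟨c, rfl⟩, rfl⟩
  refine ⟨C, fun t => hmeas' _ (hCM t), hCP, fun s t hst => ?_, fun t c h => ?_, fun t c h => ?_⟩
  · refine measure_sdiff_null_of_total (hmeas' _ (hCM t)) (htot' _ (hCM s) _ (hCM t)) ?_
    rw [hCP, hCP]
    exact ENNReal.ofReal_le_ofReal hst
  · exact measure_sdiff_null_of_total (hlev c) (htot' _ (hCM t) _ (hlevM c)) (by rwa [hCP])
  · exact measure_sdiff_null_of_total (hmeas' _ (hCM t)) (htot' _ (hlevM c) _ (hCM t))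
      (by rwa [hCP])

/-- On a non-atomic probability space there is a uniformly distributed random variable through
which a given `Y` factors monotonically. -/
theorem IsNonAtomic.exists_refining_uniform [IsProbabilityMeasure P] (hP : IsNonAtomic P)
    {Y : Ω → ℝ} (hY : Measurable Y) :
    ∃ U : Ω → unitInterval, MeasurePreserving U P volume ∧
      ∀ᵐ ω ∂P, ∀ c : ℚ, ((U ω : ℝ) < P.real {ω | Y ω ≤ c} → Y ω ≤ c) ∧
        (P.real {ω | Y ω ≤ c} < U ω → c < Y ω) := by
  classical
  obtain ⟨C, hCm, hCP, hmono, hlow, hup⟩ := hP.exists_refining_chain hY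
  let d := TopologicalSpace.denseSeq unitInterval
  have hd : ∀ a b : unitInterval, a < b → ∃ n, a < d n ∧ d n < b := fun a b hab => by
    obtain ⟨x, hx⟩ := exists_between hab
    exact (TopologicalSpace.denseRange_denseSeq unitInterval).exists_mem_open
      (isOpen_Ioo (a := a) (b := b)) ⟨x, hx⟩
  -- `U ω` is the index at which `ω` enters the chain, computed along a countable dense set for
  -- measurability. The default `1` is the top element, so it never affects the infimum.
  let U : Ω → unitInterval := fun ω => ⨅ n, if ω ∈ C (d n) then d n else 1
  have hUm : Measurable U := Measurable.iInf fun n =>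
    Measurable.ite (hCm _) measurable_const measurable_const
  have hUlt : ∀ ω u, U ω < u ↔ ∃ n, ω ∈ C (d n) ∧ d n < u := fun ω u => by
    rw [iInf_lt_iff]
    refine exists_congr fun n => ?_
    split_ifs with h
    · simp [h]
    · simp only [h, false_and, iff_false, not_lt]
      exact unitInterval.le_one'
  have hUle : ∀ ω n, ω ∈ C (d n) → U ω ≤ d n := fun ω n h => (iInf_le _ n).trans (by simp [h])
  have hPU : ∀ u, P {ω | U ω < u} ≤ ENNReal.ofReal u := fun u => by
    rw [← hCP u]
    refine measure_le_of_sdiff_null ?_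
    have : {ω | U ω < u} \ C u ⊆ ⋃ n ∈ {n | d n < u}, C (d n) \ C u := by
      rintro ω ⟨hω, hωu⟩
      obtain ⟨n, hn, hnu⟩ := (hUlt ω u).1 hω
      exact mem_biUnion (show n ∈ {n | d n < u} from hnu) ⟨hn, hωu⟩
    exact measure_mono_null this ((measure_biUnion_null_iff (to_countable _)).2
      fun n hn => hmono _ _ (le_of_lt hn))
  have hlaw : ∀ u, P {ω | U ω ≤ u} = ENNReal.ofReal u := fun u => by
    apply le_antisymm
    · refine le_of_forall_gt_imp_ge_of_dense fun b hb => ?_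
      rcases le_total 1 b with h1 | h1
      · exact prob_le_one.trans h1
      · have hbt : b ≠ ∞ := ne_top_of_le_ne_top ENNReal.one_ne_top h1
        let v : unitInterval := ⟨b.toReal, ENNReal.toReal_nonneg, ENNReal.toReal_le_of_le_ofReal
          zero_le_one (by simpa using h1)⟩
        have huv : u < v := (ENNReal.ofReal_lt_iff_lt_toReal u.2.1 hbt).1 hb
        calc P {ω | U ω ≤ u} ≤ P {ω | U ω < v} :=
              measure_mono fun ω (hω : U ω ≤ u) => hω.trans_lt huv
          _ ≤ ENNReal.ofReal v := hPU v
          _ = b := ENNReal.ofReal_toReal hbt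
    · refine le_of_forall_lt_imp_le_of_dense fun b hb => ?_
      have hbt : b ≠ ∞ := hb.ne_top
      have hbu : b.toReal < u := (ENNReal.lt_ofReal_iff_toReal_lt hbt).1 hb
      let v : unitInterval := ⟨b.toReal, ENNReal.toReal_nonneg, hbu.le.trans u.2.2⟩
      obtain ⟨n, hvn, hnu⟩ := hd v u hbu
      calc b = ENNReal.ofReal v := (ENNReal.ofReal_toReal hbt).symm
        _ ≤ ENNReal.ofReal (d n) := ENNReal.ofReal_le_ofReal hvn.le
        _ = P (C (d n)) := (hCP _).symm
        _ ≤ P {ω | U ω ≤ u} := measure_mono fun ω hω => (hUle ω n hω).trans hnu.le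
  refine ⟨U, ⟨hUm, ?_⟩, ?_⟩
  · have := Measure.isProbabilityMeasure_map (μ := P) hUm.aemeasurable
    refine Measure.ext_of_Iic _ _ fun u => ?_
    rw [unitInterval.volume_Iic, Measure.map_apply hUm measurableSet_Iic]
    exact hlaw u
  · rw [ae_all_iff]
    intro c
    have h1 : ∀ᵐ ω ∂P, ∀ n, (ENNReal.ofReal (d n) ≤ P {ω | Y ω ≤ c} → ω ∈ C (d n) → Y ω ≤ c) ∧
        (P {ω | Y ω ≤ c} ≤ ENNReal.ofReal (d n) → Y ω ≤ c → ω ∈ C (d n)) := by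
      rw [ae_all_iff]
      refine fun n => Filter.Eventually.and ?_ ?_
      · by_cases h : ENNReal.ofReal (d n) ≤ P {ω | Y ω ≤ c}
        · filter_upwards [measure_eq_zero_iff_ae_notMem.1 (hlow _ _ h)] with ω hω _ hC
          by_contra hY
          exact hω ⟨hC, hY⟩
        · exact Eventually.of_forall fun ω h' => absurd h' h
      · by_cases h : P {ω | Y ω ≤ c} ≤ ENNReal.ofReal (d n)
        · filter_upwards [measure_eq_zero_iff_ae_notMem.1 (hup _ _ h)] with ω hω _ hC
          by_contra hY
          exact hω ⟨hC, hY⟩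
        · exact Eventually.of_forall fun ω h' => absurd h' h
    let F : unitInterval := ⟨P.real {ω | Y ω ≤ c}, measureReal_nonneg, measureReal_le_one⟩
    have hF : P {ω | Y ω ≤ c} = ENNReal.ofReal F := (ofReal_measureReal (measure_ne_top _ _)).symm
    filter_upwards [h1] with ω hω
    refine ⟨fun h => ?_, fun h => ?_⟩
    · obtain ⟨n, hn, hnF⟩ := (hUlt ω F).1 h
      refine (hω n).1 ?_ hn
      rw [hF]
      exact ENNReal.ofReal_le_ofReal hnF.le
    · by_contra! hY
      obtain ⟨n, hFn, hnU⟩ := hd F (U ω) h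
      refine absurd (hUle ω n ((hω n).2 ?_ hY)) (not_le.2 hnU)
      rw [hF]
      exact ENNReal.ofReal_le_ofReal hFn.le

end NonAtomic

/-! ### Quantile functions and realization of prescribed laws -/

section Quantile

/-- The (left continuous) quantile function of a probability measure on `ℝ`, with value `0` at the
end points of the unit interval. -/
noncomputable def quantile (μ : Measure ℝ) (u : unitInterval) : ℝ :=
  open scoped Classical in if 0 < u ∧ u < 1 then sInf {c : ℝ | (u : ℝ) ≤ cdf μ c} else 0

/-- Right continuity of the cdf makes the infimum attained. The set is bounded below because `0 < u`
and nonempty because `u < 1`. -/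
theorem quantile_le_iff (μ : Measure ℝ) {u : unitInterval} (h0 : 0 < u) (h1 : u < 1) {c : ℝ} :
    quantile μ u ≤ c ↔ (u : ℝ) ≤ cdf μ c := by
  have h0' : (0 : ℝ) < u := h0
  have h1' : (u : ℝ) < 1 := h1
  have hbdd : BddBelow {c : ℝ | (u : ℝ) ≤ cdf μ c} := by
    obtain ⟨b, hb⟩ := ((tendsto_cdf_atBot μ).eventually (gt_mem_nhds h0')).exists
    refine ⟨b, fun c hc => ?_⟩
    by_contra! hcb
    exact absurd (hc.trans ((monotone_cdf μ) hcb.le)) (not_le.2 hb)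
  have hne : {c : ℝ | (u : ℝ) ≤ cdf μ c}.Nonempty := by
    obtain ⟨b, hb⟩ := ((tendsto_cdf_atTop μ).eventually (lt_mem_nhds h1')).exists
    exact ⟨b, hb.le⟩
  rw [quantile, if_pos ⟨h0, h1⟩]
  refine ⟨fun h => ?_, fun h => csInf_le hbdd h⟩
  rw [← (cdf μ).iInf_Ioi_eq c]
  have : Nonempty (Ioi c) := ⟨⟨c + 1, by simp⟩⟩
  refine le_ciInf fun ⟨r, hr⟩ => ?_
  obtain ⟨a, ha, har⟩ := exists_lt_of_csInf_lt hne (h.trans_lt hr)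
  exact le_trans ha (monotone_cdf μ har.le)

theorem measurable_quantile (μ : Measure ℝ) : Measurable (quantile μ) := by
  refine measurable_of_Iic fun c => ?_
  have h : quantile μ ⁻¹' Iic c =
      (Ioo 0 1 ∩ {u : unitInterval | (u : ℝ) ≤ cdf μ c}) ∪ ((Ioo 0 1)ᶜ ∩ {_u | 0 ≤ c}) := by
    ext u
    by_cases hu : 0 < u ∧ u < 1
    · simp only [mem_preimage, mem_Iic, quantile_le_iff μ hu.1 hu.2, mem_union, mem_inter_iff,
        mem_Ioo, mem_compl_iff, mem_ofPred_eq]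
      tauto
    · simp only [mem_preimage, mem_Iic, quantile, if_neg hu, mem_union, mem_inter_iff,
        mem_Ioo, mem_compl_iff, mem_ofPred_eq]
      tauto
  rw [h]
  refine (measurableSet_Ioo.inter ?_).union (measurableSet_Ioo.compl.inter (MeasurableSet.const _))
  exact measurableSet_le measurable_subtype_coe measurable_const

theorem ae_mem_Ioo_unitInterval : ∀ᵐ u : unitInterval, 0 < u ∧ u < 1 := by
  have h0 : ∀ᵐ u : unitInterval, u ≠ 0 := by
    simp [ae_iff]
  have h1 : ∀ᵐ u : unitInterval, u ≠ 1 := by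
    simp [ae_iff]
  filter_upwards [h0, h1] with u hu0 hu1
  exact ⟨unitInterval.pos_iff_ne_zero.2 hu0, unitInterval.lt_one_iff_ne_one.2 hu1⟩

theorem map_quantile (μ : Measure ℝ) [IsProbabilityMeasure μ] :
    (volume : Measure unitInterval).map (quantile μ) = μ := by
  have := Measure.isProbabilityMeasure_map (μ := (volume : Measure unitInterval))
    (measurable_quantile μ).aemeasurable
  refine Measure.ext_of_Iic _ _ fun c => ?_
  let F : unitInterval := ⟨cdf μ c, cdf_nonneg μ c, cdf_le_one μ c⟩
  rw [Measure.map_apply (measurable_quantile μ) measurableSet_Iic, ← ofReal_cdf,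
    ← unitInterval.volume_Iic F]
  refine measure_congr ?_
  filter_upwards [ae_mem_Ioo_unitInterval] with u hu
  exact propext (quantile_le_iff μ hu.1 hu.2)

theorem quantile_le_quantile_add {μ ν : Measure ℝ} {m : ℝ} (h : ∀ c, cdf ν c ≤ cdf μ (c + m))
    {u : unitInterval} (h0 : 0 < u) (h1 : u < 1) : quantile μ u ≤ quantile ν u + m := by
  rw [quantile_le_iff μ h0 h1]
  exact ((quantile_le_iff ν h0 h1).1 le_rfl).trans (h _)

variable {Ω : Type*} [MeasurableSpace Ω] {P : Measure Ω} [IsProbabilityMeasure P]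

theorem cdf_map_eq {Y : Ω → ℝ} (hY : AEMeasurable Y P) (c : ℝ) :
    cdf (P.map Y) c = P.real {ω | Y ω ≤ c} := by
  have := Measure.isProbabilityMeasure_map hY
  rw [cdf_eq_real, map_measureReal_apply_of_aemeasurable hY measurableSet_Iic]
  rfl

theorem cdf_map_le_cdf_map_add {X Y : Ω → ℝ} (hX : AEMeasurable X P) (hY : AEMeasurable Y P)
    {m : ℝ} (h : ∀ᵐ ω ∂P, X ω ≤ Y ω + m) (c : ℝ) :
    cdf (P.map Y) c ≤ cdf (P.map X) (c + m) := by
  rw [cdf_map_eq hX, cdf_map_eq hY]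
  refine ENNReal.toReal_mono (measure_ne_top _ _) (measure_mono_ae ?_)
  filter_upwards [h] with ω hω (hc : Y ω ≤ c)
  exact hω.trans (by gcongr)

/-- A rational strictly between `Y` and the quantile at `U` would contradict the position of `U`
relative to the cdf there. -/
theorem IsNonAtomic.exists_eq_quantile_comp (hP : IsNonAtomic P) {Y : Ω → ℝ} (hY : Measurable Y) :
    ∃ U : Ω → unitInterval, MeasurePreserving U P volume ∧
      ∀ᵐ ω ∂P, Y ω = quantile (P.map Y) (U ω) := by
  obtain ⟨U, hU, hUY⟩ := hP.exists_refining_uniform hY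
  refine ⟨U, hU, ?_⟩
  -- The refining property says nothing when `U` equals a value of the cdf; a uniform variable a.s.
  -- avoids the countably many values at rational points.
  have hne : ∀ᵐ ω ∂P, ∀ c : ℚ, (U ω : ℝ) ≠ cdf (P.map Y) c := by
    rw [ae_all_iff]
    intro c
    refine hU.quasiMeasurePreserving.ae (p := fun u => (u : ℝ) ≠ cdf (P.map Y) c) ?_
    let F : unitInterval := ⟨cdf (P.map Y) c, cdf_nonneg _ c, cdf_le_one _ c⟩
    have : ∀ᵐ u : unitInterval, u ≠ F := by simp [ae_iff]
    filter_upwards [this] with u hu h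
    exact hu (Subtype.ext h)
  filter_upwards [hUY, hne, hU.quasiMeasurePreserving.ae ae_mem_Ioo_unitInterval] with ω h1 h2 h3
  rcases lt_trichotomy (Y ω) (quantile (P.map Y) (U ω)) with h | h | h
  · obtain ⟨c, hYc, hcq⟩ := exists_rat_btwn h
    rw [← not_le, quantile_le_iff _ h3.1 h3.2, not_le, cdf_map_eq hY.aemeasurable] at hcq
    exact absurd ((h1 c).2 hcq) (not_lt.2 hYc.le)
  · exact h
  · obtain ⟨c, hqc, hcY⟩ := exists_rat_btwn h
    have h4 := lt_of_le_of_ne ((quantile_le_iff _ h3.1 h3.2).1 hqc.le) (h2 c)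
    rw [cdf_map_eq hY.aemeasurable] at h4
    exact absurd ((h1 c).1 h4) (not_le.2 hcY)

theorem identDistrib_quantile_comp {X : Ω → ℝ} (hX : AEMeasurable X P) {U : Ω → unitInterval}
    (hU : MeasurePreserving U P volume) :
    IdentDistrib (fun ω => quantile (P.map X) (U ω)) X P P := by
  have := Measure.isProbabilityMeasure_map hX
  refine ⟨((measurable_quantile _).comp hU.measurable).aemeasurable, hX, ?_⟩
  change P.map (quantile (P.map X) ∘ U) = _
  rw [← Measure.map_map (measurable_quantile _) hU.measurable, hU.map_eq, map_quantile]

theorem IsNonAtomic.exists_map_eq (hP : IsNonAtomic P) {T : Type*} [MeasurableSpace T]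
    [StandardBorelSpace T] [Nonempty T] (μ : Measure T) [IsProbabilityMeasure μ] :
    ∃ G : Ω → T, Measurable G ∧ P.map G = μ := by
  obtain ⟨U, hU, -⟩ := hP.exists_refining_uniform (Y := fun _ => 0) measurable_const
  obtain ⟨g, hg, hgμ⟩ := μ.exists_measurable_map_eq
  exact ⟨g ∘ U, hg.comp hU.measurable, by rw [← Measure.map_map hg hU.measurable, hU.map_eq, hgμ]⟩

/-- On a non-atomic probability space, countably many measures of total mass at most `1` are
realized on disjoint events. -/
theorem IsNonAtomic.exists_disjoint_realization (hP : IsNonAtomic P) {ι T : Type*} [Countable ι]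
    [MeasurableSpace T] [StandardBorelSpace T] [Nonempty T] (ν : ι → Measure T)
    (hν : ∑' i, ν i univ ≤ 1) :
    ∃ (B : ι → Set Ω) (G : Ω → T), (∀ i, MeasurableSet (B i)) ∧ Measurable G ∧
      (Pairwise fun i j => Disjoint (B i) (B j)) ∧
      ∀ i S, MeasurableSet S → P (B i ∩ G ⁻¹' S) = ν i S := by
  let _ : MeasurableSpace (Option ι) := ⊤
  have : DiscreteMeasurableSpace (Option ι) := ⟨fun _ => trivial⟩
  obtain ⟨t₀⟩ := ‹Nonempty T›
  -- The first coordinate records which event occurs; `none` absorbs the missing mass and makes this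
  -- a probability.
  let π : Measure (Option ι × T) := Measure.sum (fun i => (ν i).map (Prod.mk (some i))) +
    (1 - ∑' i, ν i univ) • Measure.dirac (none, t₀)
  have hπ : ∀ A, MeasurableSet A → π A = ∑' i, ν i (Prod.mk (some i) ⁻¹' A) +
      (1 - ∑' i, ν i univ) * Measure.dirac (none, t₀) A := fun A hA => by
    simp only [π, Measure.add_apply, Measure.smul_apply, smul_eq_mul, Measure.sum_apply _ hA]
    congr 2
    ext i
    rw [Measure.map_apply measurable_prodMk_left hA]
  have : IsProbabilityMeasure π := ⟨by
    rw [hπ _ MeasurableSet.univ]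
    simpa using add_tsub_cancel_of_le hν⟩
  obtain ⟨G, hG, hGπ⟩ := hP.exists_map_eq π
  refine ⟨fun i => {ω | (G ω).1 = some i}, fun ω => (G ω).2, fun i => ?_, hG.snd, fun i j hij => ?_,
    fun i S hS => ?_⟩
  · exact hG.fst (MeasurableSet.singleton (some i))
  · refine Set.disjoint_left.2 ?_
    intro ω hi hj
    exact hij (Option.some.inj ((show (G ω).1 = some i from hi).symm.trans hj))
  · have hA : MeasurableSet (({some i} : Set (Option ι)) ×ˢ S) :=
      (MeasurableSet.singleton _).prod hS
    have h1 : {ω | (G ω).1 = some i} ∩ (fun ω => (G ω).2) ⁻¹' S = G ⁻¹' ({some i} ×ˢ S) := by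
      ext ω; simp
    rw [h1, ← Measure.map_apply hG hA, hGπ, hπ _ hA, tsum_eq_single i]
    · have h2 : Prod.mk (some i) ⁻¹' ({some i} ×ˢ S) = S := by ext; simp
      rw [h2, Measure.dirac_apply' _ hA]
      simp
    · intro j hj
      have h2 : Prod.mk (some j) ⁻¹' (({some i} : Set (Option ι)) ×ˢ S) = ∅ := by ext; simp [hj]
      rw [h2, measure_empty]

end Quantile

/-! ### The norm extended to all functions -/

namespace RISpace

variable {Ω : Type*} [MeasurableSpace Ω] {P : Measure Ω} (E : RISpace P)

/-- The norm of the r.i. space as an extended real function on all functions `Ω → ℝ`: it is `∞` for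
functions which do not represent an element of the space. -/
noncomputable def gauge (f : Ω → ℝ) : ℝ≥0∞ :=
  ⨅ X : {X : E.space // (X : Ω →ₘ[P] ℝ) =ᵐ[P] f}, ENNReal.ofReal (E.norm X.1)

variable {E}

theorem gauge_eq {f : Ω → ℝ} (X : E.space) (hX : (X : Ω →ₘ[P] ℝ) =ᵐ[P] f) :
    E.gauge f = ENNReal.ofReal (E.norm X) := by
  refine le_antisymm (iInf_le_of_le ⟨X, hX⟩ le_rfl) (le_iInf fun Y => ?_)
  have : (Y.1 : E.space) = X := Subtype.ext (AEEqFun.ext (Y.2.trans hX.symm))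
  rw [this]

theorem gauge_coe (X : E.space) : E.gauge (X : Ω →ₘ[P] ℝ) = ENNReal.ofReal (E.norm X) :=
  gauge_eq X (ae_eq_refl _)

theorem exists_of_gauge_lt_top {f : Ω → ℝ} (hf : E.gauge f < ∞) :
    ∃ X : E.space, (X : Ω →ₘ[P] ℝ) =ᵐ[P] f := by
  by_contra! h
  have : IsEmpty {X : E.space // (X : Ω →ₘ[P] ℝ) =ᵐ[P] f} := ⟨fun X => h X.1 X.2⟩
  rw [gauge, iInf_of_empty] at hf
  exact lt_irrefl _ hf

theorem norm_lt_of_gauge_lt {f : Ω → ℝ} {ε : ℝ} (X : E.space)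
    (hX : (X : Ω →ₘ[P] ℝ) =ᵐ[P] f) (h : E.gauge f < ENNReal.ofReal ε) : E.norm X < ε := by
  rw [gauge_eq X hX] at h
  exact (ENNReal.ofReal_lt_ofReal_iff_of_nonneg (apply_nonneg _ _)).1 h

theorem gauge_congr {f g : Ω → ℝ} (h : f =ᵐ[P] g) : E.gauge f = E.gauge g := by
  by_cases hf : E.gauge f < ∞
  · obtain ⟨X, hX⟩ := exists_of_gauge_lt_top hf
    rw [gauge_eq X hX, gauge_eq X (hX.trans h)]
  · by_cases hg : E.gauge g < ∞
    · obtain ⟨X, hX⟩ := exists_of_gauge_lt_top hg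
      rw [gauge_eq X hX, gauge_eq X (hX.trans h.symm)]
    · rw [not_lt_top_iff.1 hf, not_lt_top_iff.1 hg]

theorem gauge_mono {f g : Ω → ℝ} (hf : AEMeasurable f P) (h : ∀ᵐ ω ∂P, |f ω| ≤ |g ω|) :
    E.gauge f ≤ E.gauge g := by
  by_cases hg : E.gauge g < ∞
  · obtain ⟨X, hX⟩ := exists_of_gauge_lt_top hg
    have hle : |AEEqFun.mk f hf.aestronglyMeasurable| ≤ |(X : Ω →ₘ[P] ℝ)| := by
      rw [← AEEqFun.coeFn_le]
      filter_upwards [AEEqFun.coeFn_abs (AEEqFun.mk f hf.aestronglyMeasurable),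
        AEEqFun.coeFn_abs (X : Ω →ₘ[P] ℝ), AEEqFun.coeFn_mk f hf.aestronglyMeasurable, hX, h]
        with ω h1 h2 h3 h4 h5
      rwa [h1, h2, h3, h4]
    obtain ⟨hm, hn⟩ := E.solid X _ hle
    rw [gauge_eq X hX, gauge_eq ⟨_, hm⟩ (AEEqFun.coeFn_mk f hf.aestronglyMeasurable)]
    exact ENNReal.ofReal_le_ofReal hn
  · rw [not_lt_top_iff.1 hg]
    exact le_top

theorem gauge_abs {f : Ω → ℝ} (hf : AEMeasurable f P) :
    E.gauge (fun ω => |f ω|) = E.gauge f :=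
  le_antisymm (gauge_mono (measurable_norm.comp_aemeasurable hf) (by simp))
    (gauge_mono hf (by simp))

theorem gauge_identDistrib {f g : Ω → ℝ} (h : IdentDistrib f g P P) :
    E.gauge f = E.gauge g := by
  have key : ∀ {f g : Ω → ℝ}, IdentDistrib f g P P → E.gauge f ≤ E.gauge g := fun {f g} h => by
    by_cases hg : E.gauge g < ∞
    · obtain ⟨X, hX⟩ := exists_of_gauge_lt_top hg
      have hf := h.aemeasurable_fst.aestronglyMeasurable
      have hlaw : SameLaw (AEEqFun.mk f hf) (X : Ω →ₘ[P] ℝ) :=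
        ((IdentDistrib.of_ae_eq (AEEqFun.mk f hf).aemeasurable
          (AEEqFun.coeFn_mk f hf)).trans h).trans
          (IdentDistrib.of_ae_eq (X : Ω →ₘ[P] ℝ).aemeasurable hX).symm
      obtain ⟨hm, hn⟩ := E.lawInvariant X _ hlaw
      rw [gauge_eq X hX, gauge_eq ⟨_, hm⟩ (AEEqFun.coeFn_mk f hf), hn]
    · rw [not_lt_top_iff.1 hg]
      exact le_top
  exact le_antisymm (key h) (key h.symm)

theorem gauge_add (f g : Ω → ℝ) : E.gauge (f + g) ≤ E.gauge f + E.gauge g := by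
  by_cases hf : E.gauge f < ∞
  · by_cases hg : E.gauge g < ∞
    · obtain ⟨X, hX⟩ := exists_of_gauge_lt_top hf
      obtain ⟨Y, hY⟩ := exists_of_gauge_lt_top hg
      rw [gauge_eq X hX, gauge_eq Y hY, gauge_eq (X + Y)
        ((AEEqFun.coeFn_add (X : Ω →ₘ[P] ℝ) Y).trans (hX.add hY)),
        ← ENNReal.ofReal_add (apply_nonneg _ _) (apply_nonneg _ _)]
      exact ENNReal.ofReal_le_ofReal (map_add_le_add _ _ _)
    · simp [not_lt_top_iff.1 hg]
  · simp [not_lt_top_iff.1 hf]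

theorem gauge_zero : E.gauge 0 = 0 := by
  rw [gauge_eq (0 : E.space) AEEqFun.coeFn_zero]
  simp

theorem gauge_sum {ι : Type*} (s : Finset ι) (f : ι → Ω → ℝ) :
    E.gauge (∑ i ∈ s, f i) ≤ ∑ i ∈ s, E.gauge (f i) :=
  Finset.le_sum_of_subadditive _ gauge_zero.le gauge_add s f

theorem gauge_smul (c : ℝ) (f : Ω → ℝ) : E.gauge (c • f) = ENNReal.ofReal |c| * E.gauge f := by
  have key : ∀ (c : ℝ) (f : Ω → ℝ), E.gauge f < ∞ →
      E.gauge (c • f) = ENNReal.ofReal |c| * E.gauge f := fun c f hf => by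
    obtain ⟨X, hX⟩ := exists_of_gauge_lt_top hf
    rw [gauge_eq X hX, gauge_eq (c • X)
      ((AEEqFun.coeFn_smul c (X : Ω →ₘ[P] ℝ)).trans (hX.const_smul c)),
      ← ENNReal.ofReal_mul (abs_nonneg c), map_smul_eq_mul, Real.norm_eq_abs]
  by_cases hf : E.gauge f < ∞
  · exact key c f hf
  · rcases eq_or_ne c 0 with rfl | hc
    · simp [gauge_zero]
    · have : ¬ E.gauge (c • f) < ∞ := fun h => hf (by
        have := key c⁻¹ (c • f) h
        rw [inv_smul_smul₀ hc] at this
        rw [this]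
        exact ENNReal.mul_lt_top ENNReal.ofReal_lt_top h)
      rw [not_lt_top_iff.1 hf, not_lt_top_iff.1 this, ENNReal.mul_top]
      simpa using hc

theorem coeFn_cut (X : E.space) {A : Set Ω} (hA : MeasurableSet A) :
    (E.cut X hA : Ω →ₘ[P] ℝ) =ᵐ[P] A.indicator (X : Ω →ₘ[P] ℝ) :=
  AEEqFun.coeFn_mk _ ((X : Ω →ₘ[P] ℝ).aestronglyMeasurable.indicator hA)

theorem gauge_cut (X : E.space) {A : Set Ω} (hA : MeasurableSet A) :
    E.gauge (A.indicator (X : Ω →ₘ[P] ℝ)) = ENNReal.ofReal (E.norm (E.cut X hA)) :=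
  gauge_eq _ (coeFn_cut X hA)

theorem coeFn_sum_smul {ι : Type*} (s : Finset ι) (c : ι → ℝ) (Z : ι → E.space) :
    ((∑ i ∈ s, c i • Z i : E.space) : Ω →ₘ[P] ℝ) =ᵐ[P]
      ∑ i ∈ s, c i • ((Z i : Ω →ₘ[P] ℝ) : Ω → ℝ) := by
  classical
  induction s using Finset.induction_on with
  | empty => simpa using AEEqFun.coeFn_zero
  | insert i s hi ih =>
    rw [Finset.sum_insert hi, Finset.sum_insert hi]
    exact (AEEqFun.coeFn_add ((c i • Z i : E.space) : Ω →ₘ[P] ℝ) _).trans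
      ((AEEqFun.coeFn_smul (c i) (Z i : Ω →ₘ[P] ℝ)).add ih)

theorem exists_of_identDistrib {f : Ω → ℝ} {X : E.space} (h : IdentDistrib f (X : Ω →ₘ[P] ℝ) P P) :
    ∃ Z : E.space, (Z : Ω →ₘ[P] ℝ) =ᵐ[P] f ∧ SameLaw (Z : Ω →ₘ[P] ℝ) (X : Ω →ₘ[P] ℝ) := by
  obtain ⟨Z, hZ⟩ := exists_of_gauge_lt_top (f := f) (E := E) (by
    rw [gauge_identDistrib h, gauge_coe]; exact ENNReal.ofReal_lt_top)
  exact ⟨Z, hZ, (IdentDistrib.of_ae_eq (Z : Ω →ₘ[P] ℝ).aemeasurable hZ).trans h⟩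

theorem gauge_le_mul_indicator {f : Ω → ℝ} {A : Set Ω} {c : ℝ} (hf : AEMeasurable f P)
    (hA : ∀ᵐ ω ∂P, |f ω| ≤ c * A.indicator 1 ω) :
    E.gauge f ≤ ENNReal.ofReal |c| * E.gauge (A.indicator 1) := by
  rw [← gauge_smul]
  refine gauge_mono hf ?_
  filter_upwards [hA] with ω hω
  exact hω.trans (le_abs_self _)

theorem mem_orderContinuousPart_iff {X : E.space} :
    X ∈ E.orderContinuousPart ↔ ∀ ε : ℝ, 0 < ε → ∃ δ : ℝ, 0 < δ ∧ ∀ A, MeasurableSet A →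
      P.real A < δ → E.gauge (A.indicator (X : Ω →ₘ[P] ℝ)) < ENNReal.ofReal ε := by
  refine forall₂_congr fun ε hε => exists_congr fun δ => and_congr_right fun _ =>
    forall₃_congr fun A hA _ => ?_
  rw [gauge_cut X hA, ENNReal.ofReal_lt_ofReal_iff hε]

/-! ### Norms of indicators and order continuity of bounded elements -/

section Indicators

variable [IsProbabilityMeasure P]

theorem identDistrib_indicator_one {A B : Set Ω} (hA : MeasurableSet A) (hB : MeasurableSet B)
    (h : P A = P B) :
    IdentDistrib (A.indicator (1 : Ω → ℝ)) (B.indicator (1 : Ω → ℝ)) P P := by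
  have hmA : Measurable (A.indicator (1 : Ω → ℝ)) := measurable_one.indicator hA
  have hmB : Measurable (B.indicator (1 : Ω → ℝ)) := measurable_one.indicator hB
  refine ⟨hmA.aemeasurable, hmB.aemeasurable, ?_⟩
  ext S hS
  rw [Measure.map_apply hmA hS, Measure.map_apply hmB hS]
  have hc : P Aᶜ = P Bᶜ := by rw [prob_compl_eq_one_sub hA, prob_compl_eq_one_sub hB, h]
  classical
  have hpre : ∀ C : Set Ω, C.indicator (1 : Ω → ℝ) ⁻¹' S = if (1 : ℝ) ∈ S then
      if (0 : ℝ) ∈ S then univ else C else if (0 : ℝ) ∈ S then Cᶜ else ∅ :=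
    fun C => by
      ext ω
      by_cases hω : ω ∈ C <;> split_ifs <;> simp [*]
  rw [hpre, hpre]
  split_ifs <;> simp [h, hc]

theorem _root_.IsNonAtomic.exists_subset_measure_eq (hP : IsNonAtomic P) {B : Set Ω}
    (hB : MeasurableSet B) {t : ℝ} (ht0 : 0 ≤ t) (ht : t ≤ P.real B) :
    ∃ A, MeasurableSet A ∧ A ⊆ B ∧ P.real A = t := by
  -- With the indicator of the complement, `B` is the level set at `0`, so chain members of smaller
  -- measure lie a.s. inside it.
  obtain ⟨C, hCm, hCP, -, hC, -⟩ := hP.exists_refining_chain (Y := Bᶜ.indicator 1)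
    (measurable_one.indicator hB.compl)
  let s : unitInterval := ⟨t, ht0, ht.trans measureReal_le_one⟩
  have hlev : {ω | Bᶜ.indicator (1 : Ω → ℝ) ω ≤ 0} = B := by
    ext ω
    by_cases hω : ω ∈ B <;> simp [hω]
  have h := hC s 0
  rw [hlev] at h
  have h0 := h (ENNReal.ofReal_le_of_le_toReal ht)
  refine ⟨C s ∩ B, (hCm s).inter hB, inter_subset_right, ?_⟩
  have h1 := measure_inter_add_sdiff (μ := P) (C s) hB
  rw [h0, add_zero] at h1
  rw [measureReal_def, h1, hCP]
  exact ENNReal.toReal_ofReal ht0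

/-- By law invariance `A` may be replaced by a subset of `B` of equal measure; solidity does the
rest. -/
theorem gauge_indicator_one_le (hP : IsNonAtomic P) {A B : Set Ω} (hA : MeasurableSet A)
    (hB : MeasurableSet B) (h : P A ≤ P B) :
    E.gauge (A.indicator 1) ≤ E.gauge (B.indicator 1) := by
  obtain ⟨C, hC, hCB, hCA⟩ := hP.exists_subset_measure_eq hB (t := P.real A) measureReal_nonneg
    (ENNReal.toReal_mono (measure_ne_top _ _) h)
  rw [gauge_identDistrib (identDistrib_indicator_one hA hC
    ((ENNReal.toReal_eq_toReal_iff' (measure_ne_top _ _) (measure_ne_top _ _)).1 hCA.symm))]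
  refine gauge_mono (measurable_one.indicator hC).aemeasurable (Eventually.of_forall fun ω => ?_)
  by_cases hω : ω ∈ C
  · simp [hω, hCB hω]
  · simp [hω]

/-- A set of measure at most `n P(B)` is exhausted by cutting off pieces of measure `P(B)`, each no
larger in norm than `B`. -/
theorem gauge_indicator_one_lt_top (hP : IsNonAtomic P) {B : Set Ω} (hB : MeasurableSet B)
    (hB0 : 0 < P B) (hBE : E.gauge (B.indicator 1) < ∞) {A : Set Ω} (hA : MeasurableSet A) :
    E.gauge (A.indicator 1) < ∞ := by
  have hB0' : 0 < P.real B := ENNReal.toReal_pos hB0.ne' (measure_ne_top _ _)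
  have key : ∀ (n : ℕ) (A : Set Ω), MeasurableSet A → P.real A ≤ n * P.real B →
      E.gauge (A.indicator 1) < ∞ := by
    intro n
    induction n with
    | zero =>
      intro A hA h
      refine (gauge_indicator_one_le hP hA hB ?_).trans_lt hBE
      have h0 : P.real A = 0 := le_antisymm (by simpa using h) measureReal_nonneg
      rw [(measureReal_eq_zero_iff (measure_ne_top _ _)).1 h0]
      exact zero_le
    | succ n ih =>
      intro A hA h
      rcases le_total (P.real A) (P.real B) with hAB | hAB
      · exact (gauge_indicator_one_le hP hA hB
          ((ENNReal.toReal_le_toReal (measure_ne_top _ _) (measure_ne_top _ _)).1 hAB)).trans_lt hBE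
      · obtain ⟨C, hC, hCA, hCB⟩ := hP.exists_subset_measure_eq hA hB0'.le hAB
        have h1 : A.indicator (1 : Ω → ℝ) = C.indicator 1 + (A \ C).indicator 1 := by
          have h2 := indicator_union_of_disjoint (disjoint_sdiff_right (s := C) (t := A))
            (1 : Ω → ℝ)
          rwa [union_sdiff_cancel hCA] at h2
        rw [h1]
        refine (gauge_add _ _).trans_lt (ENNReal.add_lt_top.2 ⟨?_, ih _ (hA.diff hC) ?_⟩)
        · exact (gauge_indicator_one_le hP hC hB ((ENNReal.toReal_le_toReal (measure_ne_top _ _)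
            (measure_ne_top _ _)).1 hCB.le)).trans_lt hBE
        · rw [measureReal_sdiff hCA hC]
          push_cast at h
          linarith
  obtain ⟨n, hn⟩ := exists_nat_ge (P.real A / P.real B)
  exact key n A hA ((div_le_iff₀ hB0').1 hn)

/-- A nonzero element exceeds some `1 / (n + 1)` on a non-null set, so the indicator of that set
belongs to the space. -/
theorem gauge_one_lt_top (hP : IsNonAtomic P) : E.gauge 1 < ∞ := by
  obtain ⟨X, hX, hX0⟩ := (Submodule.ne_bot_iff _).1 E.space_ne_bot
  have hex : ∃ n : ℕ, P {ω | ((n : ℝ) + 1)⁻¹ < |X ω|} ≠ 0 := by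
    by_contra! h
    refine hX0 (AEEqFun.ext ?_)
    have h' := ae_all_iff.2 fun n => measure_eq_zero_iff_ae_notMem.1 (h n)
    filter_upwards [h', AEEqFun.coeFn_zero (μ := P) (β := ℝ)] with ω hω h0
    rw [h0]
    by_contra hne
    obtain ⟨n, hn⟩ := exists_nat_one_div_lt (abs_pos.2 hne)
    exact hω n (by simpa using hn)
  obtain ⟨n, hn⟩ := hex
  have hB : MeasurableSet {ω | ((n : ℝ) + 1)⁻¹ < |X ω|} :=
    measurableSet_lt measurable_const X.measurable.abs
  have hBE : E.gauge ({ω | ((n : ℝ) + 1)⁻¹ < |X ω|}.indicator 1) < ∞ := by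
    calc _ ≤ E.gauge (((n : ℝ) + 1) • (X : Ω → ℝ)) := by
          refine gauge_mono (measurable_one.indicator hB).aemeasurable
            (Eventually.of_forall fun ω => ?_)
          by_cases hω : ((n : ℝ) + 1)⁻¹ < |X ω|
          · have h1 : (0 : ℝ) < n + 1 := by positivity
            rw [indicator_of_mem (by exact hω), Pi.smul_apply, smul_eq_mul, abs_mul, abs_of_pos h1,
              Pi.one_apply, abs_one]
            rw [inv_lt_iff_one_lt_mul₀' h1] at hω
            exact hω.le
          · rw [indicator_of_notMem (by exact hω), abs_zero]
            exact abs_nonneg _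
      _ < ∞ := by
          rw [gauge_smul, gauge_coe ⟨X, hX⟩]
          exact ENNReal.mul_lt_top ENNReal.ofReal_lt_top ENNReal.ofReal_lt_top
  have := gauge_indicator_one_lt_top hP hB (pos_iff_ne_zero.2 hn) hBE MeasurableSet.univ
  rwa [indicator_univ] at this

/-- Otherwise every non-null set has indicator norm at least `ε`. Then `|X| > n` on a non-null set
forces `‖X‖ ≥ n ε`, so all elements are bounded; as bounded functions always belong to the space, it
would be `L^∞`. -/
theorem gauge_indicator_one_small (hP : IsNonAtomic P) (hE : E.space.toAddSubgroup ≠ Lp ℝ ∞ P)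
    {ε : ℝ} (hε : 0 < ε) : ∃ δ : ℝ, 0 < δ ∧ ∀ A, MeasurableSet A → P.real A < δ →
      E.gauge (A.indicator 1) < ENNReal.ofReal ε := by
  by_contra! h
  have hlow : ∀ B, MeasurableSet B → P B ≠ 0 → ENNReal.ofReal ε ≤ E.gauge (B.indicator 1) := by
    intro B hB hB0
    obtain ⟨A, hA, hAB, hAε⟩ := h (P.real B) (ENNReal.toReal_pos hB0 (measure_ne_top _ _))
    exact hAε.trans (gauge_indicator_one_le hP hA hB
      ((ENNReal.toReal_le_toReal (measure_ne_top _ _) (measure_ne_top _ _)).1 hAB.le))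
  refine hE (AddSubgroup.ext fun X => ⟨fun hX => ?_, fun hX => ?_⟩)
  · obtain ⟨n, hn⟩ := exists_nat_gt (E.norm ⟨X, hX⟩ / ε)
    rw [div_lt_iff₀ hε] at hn
    have hB : MeasurableSet {ω | (n : ℝ) < |X ω|} :=
      measurableSet_lt measurable_const X.measurable.abs
    have hB0 : P {ω | (n : ℝ) < |X ω|} = 0 := by
      by_contra hB0
      have h1 : E.gauge ((n : ℝ) • {ω | (n : ℝ) < |X ω|}.indicator 1) ≤ E.gauge X := by
        refine gauge_mono ((measurable_one.indicator hB).const_smul (n : ℝ)).aemeasurable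
          (Eventually.of_forall fun ω => ?_)
        by_cases hω : (n : ℝ) < |X ω|
        · rw [Pi.smul_apply, indicator_of_mem (by exact hω)]
          simpa using hω.le
        · rw [Pi.smul_apply, indicator_of_notMem (by exact hω)]
          simp
      rw [gauge_smul, gauge_coe ⟨X, hX⟩, Nat.abs_cast] at h1
      have h2 := (mul_le_mul_right (hlow _ hB hB0) (ENNReal.ofReal n)).trans h1
      rw [← ENNReal.ofReal_mul n.cast_nonneg,
        ENNReal.ofReal_le_ofReal_iff (apply_nonneg _ _)] at h2
      exact absurd h2 (not_le.2 hn)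
    refine Lp.mem_Lp_iff_memLp.2 (memLp_top_of_bound X.aestronglyMeasurable n ?_)
    filter_upwards [measure_eq_zero_iff_ae_notMem.1 hB0] with ω hω
    exact not_lt.1 hω
  · have hmem := Lp.mem_Lp_iff_memLp.1 hX
    have hb : ∀ᵐ ω ∂P, |X ω| ≤ (eLpNorm X ∞ P).toReal * univ.indicator 1 ω := by
      filter_upwards [ae_le_eLpNormEssSup (f := X) (μ := P)] with ω hω
      rw [← eLpNorm_exponent_top] at hω
      have := ENNReal.toReal_mono hmem.2.ne hω
      simpa using this
    have hlt : E.gauge X < ∞ := (gauge_le_mul_indicator X.aemeasurable hb).trans_lt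
      (ENNReal.mul_lt_top ENNReal.ofReal_lt_top (by
        rw [indicator_univ]; exact gauge_one_lt_top hP))
    obtain ⟨Y, hY⟩ := exists_of_gauge_lt_top hlt
    rw [← AEEqFun.ext hY]
    exact Y.2

theorem mem_orderContinuousPart_of_bounded (hP : IsNonAtomic P)
    (hE : E.space.toAddSubgroup ≠ Lp ℝ ∞ P) {X : E.space} {c : ℝ}
    (hc : ∀ᵐ ω ∂P, |(X : Ω →ₘ[P] ℝ) ω| ≤ c) : X ∈ E.orderContinuousPart := by
  rw [mem_orderContinuousPart_iff]
  intro ε hε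
  have hc' : 0 < |c| + 1 := by positivity
  obtain ⟨δ, hδ, h⟩ := gauge_indicator_one_small hP hE (div_pos hε hc')
  refine ⟨δ, hδ, fun A hA hAδ => ?_⟩
  calc E.gauge (A.indicator (X : Ω →ₘ[P] ℝ))
      ≤ ENNReal.ofReal |(|c| + 1)| * E.gauge (A.indicator 1) := by
        refine gauge_le_mul_indicator ((X : Ω →ₘ[P] ℝ).measurable.indicator hA).aemeasurable ?_
        filter_upwards [hc] with ω hω
        by_cases hωA : ω ∈ A
        · simp only [indicator_of_mem hωA, Pi.one_apply, mul_one]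
          linarith [le_abs_self c]
        · simp [hωA]
    _ < ENNReal.ofReal |(|c| + 1)| * ENNReal.ofReal (ε / (|c| + 1)) := by
        refine ENNReal.mul_lt_mul_right ?_ ENNReal.ofReal_ne_top (h A hA hAδ)
        simpa using abs_pos.2 hc'.ne'
    _ = ENNReal.ofReal ε := by
        rw [← ENNReal.ofReal_mul (abs_nonneg _), abs_of_pos hc', mul_div_cancel₀ _ hc'.ne']

end Indicators

end RISpace

/-! ### Laws of sums of disjoint functions -/

section DisjointLaws

variable {Ω : Type*} [MeasurableSpace Ω] {P : Measure Ω}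

/-- Away from the value `0`, the sum coincides with its only nonzero summand, so the preimages are
a.s. disjoint. -/
theorem measure_preimage_sum_of_disjoint {ι : Type*} [Fintype ι] {F : ι → Ω → ℝ}
    (hF : ∀ i, AEMeasurable (F i) P) (hd : ∀ i j, i ≠ j → ∀ᵐ ω ∂P, F i ω = 0 ∨ F j ω = 0)
    {S : Set ℝ} (hS : MeasurableSet S) (h0 : (0 : ℝ) ∉ S) :
    P ((∑ i, F i) ⁻¹' S) = ∑ i, P (F i ⁻¹' S) := by
  have hd' : ∀ᵐ ω ∂P, ∀ i j, i ≠ j → F i ω = 0 ∨ F j ω = 0 := by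
    simp only [ae_all_iff]
    exact hd
  rw [← tsum_fintype (L := .unconditional _) (fun i => P (F i ⁻¹' S)), ← measure_iUnion₀]
  · refine measure_congr ?_
    filter_upwards [hd'] with ω hω
    refine propext ?_
    change (∑ i, F i) ω ∈ S ↔ ω ∈ ⋃ i, F i ⁻¹' S
    rw [Finset.sum_apply, mem_iUnion]
    by_cases hne : ∃ i, F i ω ≠ 0
    · obtain ⟨i, hi⟩ := hne
      have hz : ∀ j, j ≠ i → F j ω = 0 := fun j hj => (hω j i hj).resolve_right hi
      rw [Finset.sum_eq_single i (fun j _ hj => hz j hj) (by simp)]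
      refine ⟨fun h => ⟨i, h⟩, fun ⟨j, hj⟩ => ?_⟩
      rcases eq_or_ne j i with rfl | hji
      · exact hj
      · rw [mem_preimage, hz j hji] at hj
        exact absurd hj h0
    · push Not at hne
      simp [hne, h0]
  · intro i j hij
    refine measure_mono_null (fun ω hω => ?_) (ae_iff.1 (hd i j hij))
    rintro (h | h)
    · exact h0 (h ▸ hω.1)
    · exact h0 (h ▸ hω.2)
  · exact fun i => (hF i).nullMeasurable hS

variable [IsProbabilityMeasure P]

/-- Total mass `1` recovers the sets containing `0` from their complements. -/
theorem identDistrib_of_measure_preimage_eq {f g : Ω → ℝ} (hf : AEMeasurable f P)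
    (hg : AEMeasurable g P)
    (h : ∀ S, MeasurableSet S → (0 : ℝ) ∉ S → P (f ⁻¹' S) = P (g ⁻¹' S)) :
    IdentDistrib f g P P := by
  refine ⟨hf, hg, ?_⟩
  ext S hS
  rw [Measure.map_apply_of_aemeasurable hf hS, Measure.map_apply_of_aemeasurable hg hS]
  by_cases h0 : (0 : ℝ) ∈ S
  · have h1 := h Sᶜ hS.compl (by simpa using h0)
    have h2 : ∀ u : Ω → ℝ, AEMeasurable u P → P (u ⁻¹' S) = 1 - P (u ⁻¹' Sᶜ) := fun u hu => by
      rw [← prob_compl_eq_one_sub₀ (hu.nullMeasurable hS.compl), preimage_compl, compl_compl]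
    rw [h2 f hf, h2 g hg, h1]
  · exact h S hS h0

theorem identDistrib_sum_of_disjoint {ι : Type*} [Fintype ι] {F F' : ι → Ω → ℝ}
    (h : ∀ i, IdentDistrib (F i) (F' i) P P)
    (hF : ∀ i j, i ≠ j → ∀ᵐ ω ∂P, F i ω = 0 ∨ F j ω = 0)
    (hF' : ∀ i j, i ≠ j → ∀ᵐ ω ∂P, F' i ω = 0 ∨ F' j ω = 0) :
    IdentDistrib (∑ i, F i) (∑ i, F' i) P P := by
  refine identDistrib_of_measure_preimage_eq
    (Finset.aemeasurable_sum _ fun i _ => (h i).aemeasurable_fst)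
    (Finset.aemeasurable_sum _ fun i _ => (h i).aemeasurable_snd) fun S hS h0 => ?_
  rw [measure_preimage_sum_of_disjoint (fun i => (h i).aemeasurable_fst) hF hS h0,
    measure_preimage_sum_of_disjoint (fun i => (h i).aemeasurable_snd) hF' hS h0]
  exact Finset.sum_congr rfl fun i _ => (h i).measure_mem_eq hS

theorem indicator_eq_zero_or_of_disjoint {Ω : Type*} {A B : Set Ω} (h : Disjoint A B) (f g : Ω → ℝ)
    (ω : Ω) : A.indicator f ω = 0 ∨ B.indicator g ω = 0 := by
  by_cases hA : ω ∈ A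
  · exact Or.inr (indicator_of_notMem (disjoint_left.1 h hA) _)
  · exact Or.inl (indicator_of_notMem hA _)

end DisjointLaws

/-! ### Selecting a coordinate by equidistant levels of the total sum -/

section Slots

variable {N : ℕ}

/-- The sum of the first `n` coordinates of `y`. -/
noncomputable def partialSum (y : Fin N → NNReal) (n : ℕ) : ℝ :=
  ∑ i : Fin N, if i.val < n then (y i : ℝ) else 0

/-- The coordinate `j` is selected by the `v`-th of `K` equidistant levels of the total sum. -/
def IsSlot (K v : ℕ) (y : Fin N → NNReal) (j : Fin N) : Prop :=
  K * partialSum y j ≤ v * partialSum y N ∧ v * partialSum y N < K * partialSum y (j + 1)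

theorem measurable_partialSum (n : ℕ) : Measurable fun y : Fin N → NNReal => partialSum y n := by
  unfold partialSum
  refine Finset.measurable_sum _ fun i _ => ?_
  split_ifs
  · fun_prop
  · fun_prop

theorem partialSum_zero (y : Fin N → NNReal) : partialSum y 0 = 0 := by simp [partialSum]

theorem partialSum_total (y : Fin N → NNReal) : partialSum y N = ∑ i, (y i : ℝ) := by
  simp [partialSum]

theorem partialSum_succ (y : Fin N → NNReal) (j : Fin N) :
    partialSum y (j + 1) = partialSum y j + y j := by
  have h : (y j : ℝ) = ∑ i : Fin N, if i = j then (y i : ℝ) else 0 := by simp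
  rw [h, partialSum, partialSum, ← Finset.sum_add_distrib]
  refine Finset.sum_congr rfl fun i _ => ?_
  rcases lt_trichotomy i j with hij | hij | hij
  · have h1 : i.val < j.val := hij
    simp [h1, hij.ne, h1.trans (Nat.lt_succ_self _)]
  · simp [hij]
  · have h1 : j.val < i.val := hij
    simp [hij.ne', not_lt.2 h1.le, not_lt.2 (Nat.succ_le_of_lt h1)]

theorem partialSum_mono (y : Fin N → NNReal) : Monotone (partialSum y) := by
  intro m n hmn
  refine Finset.sum_le_sum fun i _ => ?_
  by_cases h : i.val < m
  · simp [h, h.trans_le hmn]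
  · simp only [h, if_false]
    split_ifs <;> simp

theorem measurableSet_isSlot (K v : ℕ) (j : Fin N) :
    MeasurableSet {y : Fin N → NNReal | IsSlot K v y j} :=
  (measurableSet_le ((measurable_partialSum _).const_mul _)
    ((measurable_partialSum _).const_mul _)).inter
    (measurableSet_lt ((measurable_partialSum _).const_mul _)
    ((measurable_partialSum _).const_mul _))

theorem IsSlot.eq {K v : ℕ} {y : Fin N → NNReal} {i j : Fin N} (hi : IsSlot K v y i)
    (hj : IsSlot K v y j) : i = j := by
  have key : ∀ {i j : Fin N}, IsSlot K v y i → IsSlot K v y j → ¬ i < j := fun {i j} hi hj hij => by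
    have h1 : partialSum y (i + 1) ≤ partialSum y j := partialSum_mono y hij
    have h2 := mul_le_mul_of_nonneg_left h1 (Nat.cast_nonneg (α := ℝ) K)
    linarith [hi.2, hj.1]
  exact le_antisymm (not_lt.1 (key hj hi)) (not_lt.1 (key hi hj))

/-- The selected half-open interval has length proportional to `y j` and is nonempty. -/
theorem IsSlot.ne_zero {K v : ℕ} {y : Fin N → NNReal} {j : Fin N} (hj : IsSlot K v y j) :
    y j ≠ 0 := by
  intro h
  have h1 := hj.1.trans_lt hj.2
  rw [partialSum_succ, h] at h1
  simp at h1

theorem exists_isSlot {K v : ℕ} (hv : v < K) {y : Fin N → NNReal} (hy : 0 < partialSum y N) :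
    ∃ j, IsSlot K v y j := by
  classical
  have hex : ∃ n, (v : ℝ) * partialSum y N < K * partialSum y n :=
    ⟨N, mul_lt_mul_of_pos_right (by exact_mod_cast hv) hy⟩
  have hle : Nat.find hex ≤ N := Nat.find_min' hex (mul_lt_mul_of_pos_right (by exact_mod_cast hv) hy)
  have h0 : Nat.find hex ≠ 0 := fun h => by
    have := Nat.find_spec hex
    rw [h, partialSum_zero, mul_zero] at this
    exact absurd this (not_lt.2 (by positivity))
  obtain ⟨m, hm⟩ := Nat.exists_eq_succ_of_ne_zero h0
  refine ⟨⟨m, by omega⟩, not_lt.1 (Nat.find_min hex (m := m) (by omega)), ?_⟩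
  have := Nat.find_spec hex
  rwa [hm] at this

/-- A half-open interval misses its length in integer points by at most one; `b ≤ K` ensures that
`range K` cuts none off. -/
theorem sub_le_card_filter {K : ℕ} {a b : ℝ} (ha : 0 ≤ a) (hb : b ≤ K) :
    b - a ≤ ((Finset.range K).filter fun v : ℕ => a ≤ v ∧ (v : ℝ) < b).card + 1 := by
  have h : ((Finset.range K).filter fun v : ℕ => a ≤ v ∧ (v : ℝ) < b) =
      Finset.Ico ⌈a⌉₊ ⌈b⌉₊ := by
    ext v
    simp only [Finset.mem_filter, Finset.mem_range, Finset.mem_Ico, Nat.ceil_le, Nat.lt_ceil]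
    refine ⟨fun h => h.2, fun h => ⟨?_, h⟩⟩
    exact_mod_cast h.2.trans_le hb
  rw [h, Nat.card_Ico]
  have h1 : (⌈b⌉₊ : ℝ) - ⌈a⌉₊ ≤ ((⌈b⌉₊ - ⌈a⌉₊ : ℕ) : ℝ) := by
    rw [sub_le_iff_le_add]
    exact_mod_cast le_tsub_add
  linarith [Nat.le_ceil b, Nat.ceil_lt_add_one ha]

open scoped Classical in
-- When the total is positive, the levels selecting `j` are the integers in an interval of length `K
-- y j / partialSum y N`; the extra total pays for the rounding.
theorem mul_le_sum_isSlot (K : ℕ) (y : Fin N → NNReal) (j : Fin N) :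
    K * (y j : ℝ) ≤ (∑ v ∈ Finset.range K, if IsSlot K v y j then partialSum y N else 0) +
      partialSum y N := by
  have hS : 0 ≤ partialSum y N := by
    rw [← partialSum_zero y]
    exact partialSum_mono y (Nat.zero_le _)
  have hj0 : 0 ≤ partialSum y j := by
    rw [← partialSum_zero y]
    exact partialSum_mono y (Nat.zero_le _)
  have hjS : partialSum y (j + 1) ≤ partialSum y N := partialSum_mono y j.2
  have hsucc := partialSum_succ y j
  rcases hS.eq_or_lt with h | h
  · have hyj : (y j : ℝ) = 0 := le_antisymm (by linarith) (y j).2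
    rw [hyj, ← h]
    simp
  · have hcount := sub_le_card_filter (K := K) (a := K * partialSum y j / partialSum y N)
      (b := K * partialSum y (j + 1) / partialSum y N) (by positivity) (by
        rw [div_le_iff₀ h]; gcongr)
    rw [← Finset.sum_filter, Finset.sum_const, nsmul_eq_mul]
    have hfilter : ((Finset.range K).filter fun v => IsSlot K v y j) =
        (Finset.range K).filter fun v : ℕ => K * partialSum y j / partialSum y N ≤ v ∧
          (v : ℝ) < K * partialSum y (j + 1) / partialSum y N := by
      refine Finset.filter_congr fun v _ => ?_
      rw [div_le_iff₀ h, lt_div_iff₀ h, IsSlot]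
    rw [hfilter]
    have h2 := mul_le_mul_of_nonneg_right hcount hS
    rw [sub_mul, div_mul_cancel₀ _ h.ne', div_mul_cancel₀ _ h.ne'] at h2
    have h3 : K * partialSum y (j + 1) = K * partialSum y j + K * (y j : ℝ) := by rw [hsucc]; ring
    linarith

end Slots

/-! ### Disjoint sums have the least norm -/

namespace RISpace

variable {Ω : Type*} [MeasurableSpace Ω] {P : Measure Ω} [IsProbabilityMeasure P] {E : RISpace P}

/-- The norm of a disjoint sum is at most the norm of any sum of nonnegative functions which are
equimeasurable with the absolute values of the summands. -/
theorem gauge_disjoint_sum_le (hP : IsNonAtomic P) {N : ℕ} {f : Fin N → Ω → NNReal}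
    (hf : ∀ j, Measurable (f j)) {D : Fin N → Ω → ℝ}
    (hD : ∀ i j, i ≠ j → ∀ᵐ ω ∂P, D i ω = 0 ∨ D j ω = 0)
    (hDf : ∀ j, IdentDistrib (fun ω => |D j ω|) (fun ω => (f j ω : ℝ)) P P)
    (hDm : ∀ j, AEMeasurable (D j) P) :
    E.gauge (∑ j, D j) ≤ E.gauge (∑ j, fun ω => (f j ω : ℝ)) := by
  classical
  have hDabs : ∀ i j, i ≠ j → ∀ᵐ ω ∂P, |D i ω| = 0 ∨ |D j ω| = 0 := by simpa using hD
  let Φ : Ω → Fin N → NNReal := fun ω j => f j ω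
  have hΦ : Measurable Φ := measurable_pi_lambda _ hf
  have hsupp : ∀ j, MeasurableSet {y : Fin N → NNReal | y j ≠ 0} := fun j =>
    (measurable_pi_apply j (MeasurableSet.singleton 0)).compl
  -- The `j`-th piece carries the joint law of all the `f i` on `{f j ≠ 0}`, so functions of the
  -- whole vector can be transported to it.
  let ν : Fin N → Measure (Fin N → NNReal) := fun j => (P.map Φ).restrict {y | y j ≠ 0}
  have hν : ∀ j S, MeasurableSet S → ν j S = P (Φ ⁻¹' S ∩ {ω | f j ω ≠ 0}) := fun j S hS => by
    rw [Measure.restrict_apply hS, Measure.map_apply hΦ (hS.inter (hsupp j))]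
    rfl
  -- The masses are those of the supports of the disjoint `D j`, which is why they fit into the
  -- space.
  have hmass : ∑' j, ν j univ ≤ 1 := by
    rw [tsum_fintype]
    have h1 : ∀ j, ν j univ = P ((fun ω => |D j ω|) ⁻¹' {0}ᶜ) := fun j => by
      rw [hν j _ MeasurableSet.univ, (hDf j).measure_mem_eq (MeasurableSet.singleton 0).compl]
      congr 1
      ext ω
      simp
    simp_rw [h1]
    rw [← measure_preimage_sum_of_disjoint (fun j => (hDf j).aemeasurable_fst) hDabs
      (MeasurableSet.singleton 0).compl (by simp)]
    exact prob_le_one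
  obtain ⟨B, G, hB, hG, hBd, hBG⟩ := hP.exists_disjoint_realization ν hmass
  have hone : ∀ (j : Fin N) (h : (Fin N → NNReal) → ℝ), Measurable h →
      IdentDistrib ((B j).indicator (h ∘ G)) ({ω | f j ω ≠ 0}.indicator (h ∘ Φ)) P P := by
    intro j h hh
    have hA : MeasurableSet {ω | f j ω ≠ 0} := hΦ (hsupp j)
    refine identDistrib_of_measure_preimage_eq ((hh.comp hG).indicator (hB j)).aemeasurable
      ((hh.comp hΦ).indicator hA).aemeasurable fun S hS h0 => ?_
    have hpre : ∀ (A : Set Ω) (g : Ω → ℝ), A.indicator g ⁻¹' S = g ⁻¹' S ∩ A := fun A g => by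
      ext ω
      by_cases hω : ω ∈ A <;> simp [hω, h0]
    rw [hpre, hpre, inter_comm, preimage_comp, hBG j _ (hh hS), hν j _ (hh hS), preimage_comp]
  have hBdis : ∀ (h : Fin N → (Fin N → NNReal) → ℝ) (i j : Fin N), i ≠ j →
      ∀ᵐ ω ∂P, (B i).indicator (h i ∘ G) ω = 0 ∨ (B j).indicator (h j ∘ G) ω = 0 :=
    fun h i j hij => Eventually.of_forall (indicator_eq_zero_or_of_disjoint (hBd hij) _ _)
  set g := E.gauge (∑ j, fun ω => (f j ω : ℝ)) with hg
  let T : (Fin N → NNReal) → ℝ := fun y => partialSum y N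
  have hT : Measurable T := measurable_partialSum N
  have hT0 : ∀ y, 0 ≤ T y := fun y => by
    rw [← partialSum_zero y]
    exact partialSum_mono y (Nat.zero_le _)
  have hTΦ : (∑ j, fun ω => (f j ω : ℝ)) = T ∘ Φ := by
    ext ω
    simp [T, Φ, partialSum_total]
  -- the transported disjoint sum
  have hDg : E.gauge (∑ j, D j) = E.gauge (∑ j, (B j).indicator ((fun y => (y j : ℝ)) ∘ G)) := by
    rw [← gauge_abs (Finset.aemeasurable_sum _ fun j _ => hDm j)]
    have h1 : (fun ω => |(∑ j, D j) ω|) =ᵐ[P] ∑ j, fun ω => |D j ω| := by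
      have hD' : ∀ᵐ ω ∂P, ∀ i j, i ≠ j → D i ω = 0 ∨ D j ω = 0 := by
        simp only [ae_all_iff]
        exact hD
      filter_upwards [hD'] with ω hω
      rw [Finset.sum_apply, Finset.sum_apply]
      by_cases hne : ∃ i, D i ω ≠ 0
      · obtain ⟨i, hi⟩ := hne
        have hz : ∀ j, j ≠ i → D j ω = 0 := fun j hj => (hω j i hj).resolve_right hi
        rw [Finset.sum_eq_single i (fun j _ hj => hz j hj) (by simp),
          Finset.sum_eq_single i (fun j _ hj => by rw [hz j hj, abs_zero]) (by simp)]
      · push Not at hne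
        simp [hne]
    rw [gauge_congr h1]
    refine gauge_identDistrib (identDistrib_sum_of_disjoint (fun j => ?_) hDabs
      (hBdis fun j y => (y j : ℝ)))
    refine (hDf j).trans (IdentDistrib.symm ?_)
    have h2 : {ω | f j ω ≠ 0}.indicator ((fun y : Fin N → NNReal => (y j : ℝ)) ∘ Φ) =
        fun ω => (f j ω : ℝ) := by
      ext ω
      by_cases hω : f j ω = 0 <;> simp [hω, Φ]
    rw [← h2]
    exact hone j _ (by fun_prop)
  let W : ℕ → ℕ → Fin N → (Fin N → NNReal) → ℝ := fun K v j y => if IsSlot K v y j then T y else 0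
  have hWm : ∀ K v j, Measurable (W K v j) := fun K v j =>
    Measurable.ite (measurableSet_isSlot K v j) hT measurable_const
  -- On the original side exactly one slot is active wherever the total is positive, so the summands
  -- are disjoint and add up to the total itself.
  have hWg : ∀ K v, v < K → E.gauge (∑ j, (B j).indicator (W K v j ∘ G)) = g := by
    intro K v hv
    have hsel : ∀ ω j, {ω | f j ω ≠ 0}.indicator (W K v j ∘ Φ) ω = W K v j (Φ ω) := fun ω j => by
      by_cases hω : f j ω = 0
      · have : ¬ IsSlot K v (Φ ω) j := fun h => h.ne_zero hω
        simp [hω, W, this]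
      · simp [hω]
    have hsum : ∑ j, {ω | f j ω ≠ 0}.indicator (W K v j ∘ Φ) = T ∘ Φ := by
      ext ω
      simp only [Finset.sum_apply, hsel]
      rcases (hT0 (Φ ω)).eq_or_lt with h | h
      · simp [W, ← h]
      · obtain ⟨i, hi⟩ := exists_isSlot hv h
        rw [Finset.sum_eq_single i]
        · simp [W, hi]
        · intro j _ hj
          exact if_neg fun h' => hj (h'.eq hi)
        · simp
    rw [hg, hTΦ, ← hsum]
    refine gauge_identDistrib (identDistrib_sum_of_disjoint (fun j => hone j _ (hWm K v j))
      (hBdis _) fun i j hij => Eventually.of_forall fun ω => ?_)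
    rw [hsel, hsel]
    by_cases h : IsSlot K v (Φ ω) i
    · exact Or.inr (if_neg fun h' => hij (h.eq h'))
    · exact Or.inl (if_neg h)
  -- The crude factor `N` is harmless, since this term is later divided by `K`.
  have hTg : E.gauge (∑ j, (B j).indicator (T ∘ G)) ≤ N * g := by
    refine (gauge_sum _ _).trans ?_
    have : ∀ j, E.gauge ((B j).indicator (T ∘ G)) ≤ g := fun j => by
      rw [gauge_identDistrib (hone j T hT), hg, hTΦ]
      refine gauge_mono ((hT.comp hΦ).indicator (hΦ (hsupp j))).aemeasurable
        (Eventually.of_forall fun ω => ?_)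
      by_cases hω : f j ω = 0 <;> simp [hω]
    calc _ ≤ ∑ _j : Fin N, g := Finset.sum_le_sum fun j _ => this j
      _ = N * g := by simp
  have hmain : ∀ K : ℕ, 0 < K → E.gauge (∑ j, D j) ≤ g + ENNReal.ofReal (K : ℝ)⁻¹ * (N * g) := by
    intro K hK
    have hK' : (0 : ℝ) < K := by exact_mod_cast hK
    rw [hDg]
    have hdom : E.gauge (∑ j, (B j).indicator ((fun y => (y j : ℝ)) ∘ G)) ≤
        E.gauge ((K : ℝ)⁻¹ • (∑ v ∈ Finset.range K, ∑ j, (B j).indicator (W K v j ∘ G)) +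
          (K : ℝ)⁻¹ • ∑ j, (B j).indicator (T ∘ G)) := by
      refine gauge_mono (Finset.aemeasurable_sum _ fun j _ =>
        ((by fun_prop : Measurable fun ω => (G ω j : ℝ)).indicator (hB j)).aemeasurable)
        (Eventually.of_forall fun ω => ?_)
      have h1 : ∀ j, (B j).indicator ((fun y => (y j : ℝ)) ∘ G) ω ≤ (K : ℝ)⁻¹ *
          ((∑ v ∈ Finset.range K, (B j).indicator (W K v j ∘ G) ω) +
            (B j).indicator (T ∘ G) ω) := fun j => by
        by_cases hω : ω ∈ B j
        · simp only [indicator_of_mem hω, Function.comp_apply]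
          rw [le_inv_mul_iff₀ hK']
          exact mul_le_sum_isSlot K (G ω) j
        · simp [hω]
      have h0 : ∀ j, 0 ≤ (B j).indicator ((fun y => (y j : ℝ)) ∘ G) ω := fun j =>
        indicator_nonneg (fun _ _ => NNReal.coe_nonneg _) _
      rw [Finset.sum_apply, abs_of_nonneg (Finset.sum_nonneg fun j _ => h0 j)]
      refine (Finset.sum_le_sum fun j _ => h1 j).trans ((le_of_eq ?_).trans (le_abs_self _))
      rw [← Finset.mul_sum, Finset.sum_add_distrib, Finset.sum_comm]
      simp only [Pi.add_apply, Pi.smul_apply, Finset.sum_apply, smul_eq_mul, mul_add]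
    refine hdom.trans ((gauge_add _ _).trans (add_le_add ?_ ?_))
    · rw [gauge_smul, abs_of_pos (inv_pos.2 hK')]
      calc _ ≤ ENNReal.ofReal (K : ℝ)⁻¹ * ∑ v ∈ Finset.range K, g := by
            gcongr
            refine (gauge_sum _ _).trans (Finset.sum_le_sum fun v hv => ?_)
            exact (hWg K v (Finset.mem_range.1 hv)).le
        _ = g := by
            rw [Finset.sum_const, Finset.card_range, nsmul_eq_mul, ← mul_assoc,
              ← ENNReal.ofReal_natCast, ← ENNReal.ofReal_mul (by positivity),
              inv_mul_cancel₀ hK'.ne', ENNReal.ofReal_one, one_mul]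
    · rw [gauge_smul, abs_of_pos (inv_pos.2 hK')]
      gcongr
  refine ENNReal.le_of_forall_pos_le_add fun ε hε hlt => ?_
  have hfin : (N : ℝ≥0∞) * g ≠ ∞ := ENNReal.mul_ne_top (by simp) hlt.ne
  obtain ⟨K, hK⟩ := exists_nat_gt (((N : ℝ≥0∞) * g).toReal / ε)
  have hε' : (0 : ℝ) < ε := hε
  have hK0 : (0 : ℝ) < K := lt_of_le_of_lt (by positivity) hK
  refine (hmain K (by exact_mod_cast hK0)).trans ?_
  gcongr
  rw [← ENNReal.ofReal_toReal hfin, ← ENNReal.ofReal_mul (by positivity),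
    ← ENNReal.ofReal_coe_nnreal]
  refine ENNReal.ofReal_le_ofReal ?_
  rw [inv_mul_le_iff₀ hK0]
  exact ((div_lt_iff₀ hε').1 hK).le

end RISpace

/-! ### Comparing rearrangements through a common uniform variable -/

section Rearrangement

variable {Ω : Type*} [MeasurableSpace Ω] {P : Measure Ω} [IsProbabilityMeasure P]

theorem ae_quantile_comp_le_add {X Y : Ω → ℝ} (hX : AEMeasurable X P) (hY : AEMeasurable Y P)
    {m : ℝ} (h : ∀ᵐ ω ∂P, X ω ≤ Y ω + m) {U : Ω → unitInterval}
    (hU : MeasurePreserving U P volume) :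
    ∀ᵐ ω ∂P, quantile (P.map X) (U ω) ≤ quantile (P.map Y) (U ω) + m := by
  filter_upwards [hU.quasiMeasurePreserving.ae ae_mem_Ioo_unitInterval] with ω hω
  exact quantile_le_quantile_add (cdf_map_le_cdf_map_add hX hY h) hω.1 hω.2

theorem ae_quantile_comp_nonneg {X : Ω → ℝ} (hX : AEMeasurable X P) (h : ∀ᵐ ω ∂P, 0 ≤ X ω)
    {U : Ω → unitInterval} (hU : MeasurePreserving U P volume) :
    ∀ᵐ ω ∂P, 0 ≤ quantile (P.map X) (U ω) :=
  (identDistrib_quantile_comp hX hU).symm.ae_snd (p := fun x => 0 ≤ x) measurableSet_Ici h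

theorem IsNonAtomic.exists_eq_quantile_of_identDistrib (hP : IsNonAtomic P) {Y W : Ω → ℝ}
    (hY : Measurable Y) (hYW : IdentDistrib Y W P P) :
    ∃ U : Ω → unitInterval, MeasurePreserving U P volume ∧
      ∀ᵐ ω ∂P, Y ω = quantile (P.map W) (U ω) := by
  obtain ⟨U, hU, h⟩ := hP.exists_eq_quantile_comp hY
  exact ⟨U, hU, by rwa [hYW.map_eq] at h⟩

/-- A function below `W` can be rearranged to lie below a given rearrangement of `W`. -/
theorem IsNonAtomic.exists_identDistrib_le (hP : IsNonAtomic P) {Y W V : Ω → ℝ}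
    (hY : Measurable Y) (hYW : IdentDistrib Y W P P) (hV : AEMeasurable V P)
    (h0 : ∀ᵐ ω ∂P, 0 ≤ V ω) (hVW : ∀ᵐ ω ∂P, V ω ≤ W ω) :
    ∃ f : Ω → NNReal, Measurable f ∧ IdentDistrib (fun ω => (f ω : ℝ)) V P P ∧
      ∀ᵐ ω ∂P, (f ω : ℝ) ≤ Y ω := by
  obtain ⟨U, hU, hYU⟩ := hP.exists_eq_quantile_of_identDistrib hY hYW
  have hm : Measurable fun ω => quantile (P.map V) (U ω) :=
    (measurable_quantile _).comp hU.measurable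
  have hnn := ae_quantile_comp_nonneg hV h0 hU
  have hf : (fun ω => ((quantile (P.map V) (U ω)).toNNReal : ℝ)) =ᵐ[P]
      fun ω => quantile (P.map V) (U ω) := by
    filter_upwards [hnn] with ω hω
    exact Real.coe_toNNReal _ hω
  refine ⟨fun ω => (quantile (P.map V) (U ω)).toNNReal, hm.real_toNNReal, ?_, ?_⟩
  · exact (IdentDistrib.of_ae_eq hm.real_toNNReal.coe_nnreal_real.aemeasurable hf).trans
      (identDistrib_quantile_comp hV hU)
  · filter_upwards [hf, hYU, ae_quantile_comp_le_add (m := 0) hV hYW.aemeasurable_snd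
      (by simpa using hVW) hU] with ω h1 h2 h3
    rw [h1, h2]
    simpa using h3

/-- Version of `IsNonAtomic.exists_identDistrib_le` which localizes the rearranged function to a
set of the same measure as the set carrying the original one. -/
theorem IsNonAtomic.exists_identDistrib_indicator_le (hP : IsNonAtomic P) {Y X : Ω → ℝ}
    (hY : Measurable Y) (hX : Measurable X) (hYX : IdentDistrib Y X P P) (h0 : ∀ᵐ ω ∂P, 0 ≤ X ω)
    {A : Set Ω} (hA : MeasurableSet A) :
    ∃ (f : Ω → ℝ) (C : Set Ω), IdentDistrib f (A.indicator X) P P ∧ MeasurableSet C ∧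
      P.real C = P.real A ∧ ∀ᵐ ω ∂P, 0 ≤ f ω ∧ f ω ≤ Y ω ∧ (ω ∉ C → f ω = 0) := by
  obtain ⟨U, hU, hYU⟩ := hP.exists_eq_quantile_of_identDistrib hY hYX
  have hXA : AEMeasurable (A.indicator X) P := (hX.indicator hA).aemeasurable
  -- The quantile of `A.indicator X` vanishes up to level `P.real Aᶜ`, so `{U > s}` carries the
  -- rearranged function.
  let s : unitInterval := ⟨1 - P.real A, sub_nonneg.2 measureReal_le_one,
    sub_le_self _ measureReal_nonneg⟩
  have hXA0 : ∀ᵐ ω ∂P, 0 ≤ A.indicator X ω := by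
    filter_upwards [h0] with ω hω
    exact indicator_apply_nonneg fun _ => hω
  have hXAX : ∀ᵐ ω ∂P, A.indicator X ω ≤ X ω + 0 := by
    filter_upwards [h0] with ω hω
    rw [add_zero]
    exact indicator_apply_le' (fun _ => le_rfl) fun _ => hω
  refine ⟨fun ω => quantile (P.map (A.indicator X)) (U ω), U ⁻¹' Ioi s,
    identDistrib_quantile_comp hXA hU, hU.measurable measurableSet_Ioi, ?_, ?_⟩
  · rw [measureReal_def, hU.measure_preimage measurableSet_Ioi.nullMeasurableSet,
      unitInterval.volume_Ioi, sub_sub_cancel, ENNReal.toReal_ofReal measureReal_nonneg]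
  · filter_upwards [hYU, ae_quantile_comp_nonneg hXA hXA0 hU,
      ae_quantile_comp_le_add hXA hX.aemeasurable hXAX hU,
      hU.quasiMeasurePreserving.ae ae_mem_Ioo_unitInterval] with ω h1 h2 h3 h4
    refine ⟨h2, by rw [h1]; simpa using h3, fun hω => le_antisymm ?_ h2⟩
    rw [quantile_le_iff _ h4.1 h4.2, cdf_map_eq hXA]
    calc (U ω : ℝ) ≤ s := not_lt.1 hω
      _ = P.real Aᶜ := (probReal_compl_eq_one_sub hA).symm
      _ ≤ _ := measureReal_mono fun ω' hω' => by simp [indicator_of_notMem hω']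

/-- Writing `Z` as the quantile of `W` at `U`, take for `Y` the quantile of `X` at the same `U`. -/
theorem IsNonAtomic.exists_identDistrib_abs_sub_le (hP : IsNonAtomic P) {Z W X : Ω → ℝ}
    (hZ : Measurable Z) (hZW : IdentDistrib Z W P P) (hX : AEMeasurable X P) {m : ℝ}
    (hWX : ∀ᵐ ω ∂P, W ω ≤ X ω) (hXW : ∀ᵐ ω ∂P, X ω ≤ W ω + m) :
    ∃ Y : Ω → ℝ, IdentDistrib Y X P P ∧ ∀ᵐ ω ∂P, |Y ω - Z ω| ≤ m := by
  obtain ⟨U, hU, hZU⟩ := hP.exists_eq_quantile_of_identDistrib hZ hZW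
  refine ⟨_, identDistrib_quantile_comp hX hU, ?_⟩
  filter_upwards [hZU, ae_quantile_comp_le_add (m := 0) hZW.aemeasurable_snd hX
    (by simpa using hWX) hU, ae_quantile_comp_le_add hX hZW.aemeasurable_snd hXW hU] with ω h1 h2 h3
  rw [h1, abs_le]
  constructor <;> linarith

theorem tendsto_measureReal_of_antitone {A : ℕ → Set Ω} (hA : ∀ n, MeasurableSet (A n))
    (hanti : Antitone A) (hempty : ⋂ n, A n = ∅) : Tendsto (fun n => P.real (A n)) atTop (𝓝 0) := by
  have h := tendsto_measure_iInter_atTop (μ := P) (fun n => (hA n).nullMeasurableSet) hanti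
    ⟨0, measure_ne_top _ _⟩
  rw [hempty, measure_empty] at h
  exact (ENNReal.tendsto_toReal ENNReal.zero_ne_top).comp h

end Rearrangement

/-! ### The implications between the averaging conditions -/

namespace RISpace

variable {Ω : Type*} [MeasurableSpace Ω] {P : Measure Ω} {E : RISpace P}

theorem sameLaw_cut_iff {Z : Ω →ₘ[P] ℝ} {X : E.space} {A : Set Ω} (hA : MeasurableSet A) :
    SameLaw Z (E.cut X hA : Ω →ₘ[P] ℝ) ↔
      IdentDistrib Z (A.indicator (X : Ω →ₘ[P] ℝ)) P P := by
  have h : IdentDistrib (E.cut X hA : Ω →ₘ[P] ℝ) (A.indicator (X : Ω →ₘ[P] ℝ)) P P :=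
    IdentDistrib.of_ae_eq (E.cut X hA : Ω →ₘ[P] ℝ).aemeasurable (coeFn_cut X hA)
  exact ⟨fun hZ => IdentDistrib.trans hZ h, fun hZ => IdentDistrib.trans hZ h.symm⟩

theorem ae_nonneg_of_nonneg {X : E.space} (hX : 0 ≤ (X : Ω →ₘ[P] ℝ)) :
    ∀ᵐ ω ∂P, 0 ≤ (X : Ω →ₘ[P] ℝ) ω := by
  filter_upwards [AEEqFun.coeFn_le.2 hX, AEEqFun.coeFn_zero (μ := P) (β := ℝ)] with ω h1 h2
  rw [h2] at h1
  exact h1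

theorem exists_of_identDistrib_indicator {f : Ω → ℝ} {X : E.space} {A : Set Ω}
    (hA : MeasurableSet A) (h : IdentDistrib f (A.indicator (X : Ω →ₘ[P] ℝ)) P P) :
    ∃ Z : E.space, (Z : Ω →ₘ[P] ℝ) =ᵐ[P] f ∧
      SameLaw (Z : Ω →ₘ[P] ℝ) (E.cut X hA : Ω →ₘ[P] ℝ) :=
  exists_of_identDistrib (h.trans (IdentDistrib.of_ae_eq (E.cut X hA : Ω →ₘ[P] ℝ).aemeasurable
    (coeFn_cut X hA)).symm)

variable [IsProbabilityMeasure P]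

theorem ConvexAveraging.aocea (hP : IsNonAtomic P) (hE : E.space.toAddSubgroup ≠ Lp ℝ ∞ P)
    (h : E.ConvexAveraging) : E.AOCEA := by
  intro X hX
  have hX0 := ae_nonneg_of_nonneg hX
  refine ⟨?_, fun b hb => ?_⟩
  · rintro _ ⟨Y, -, V, -, rfl⟩
    exact apply_nonneg _ _
  by_contra! hb0
  -- A supposed positive lower bound `b` of the distances serves as the tolerance.
  obtain ⟨k, n, Z, c, hZ, hc0, hc1, hlt⟩ := h X hX b hb0
    (fun n => {ω | (n : ℝ) < (X : Ω →ₘ[P] ℝ) ω})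
    (fun n => measurableSet_lt measurable_const (X : Ω →ₘ[P] ℝ).measurable)
    (fun m n hmn ω (hω : (n : ℝ) < _) => lt_of_le_of_lt (Nat.cast_le.2 hmn) hω)
    (by
      refine eq_empty_of_forall_notMem fun ω hω => ?_
      obtain ⟨n, hn⟩ := exists_nat_ge ((X : Ω →ₘ[P] ℝ) ω)
      exact not_lt.2 hn (mem_iInter.1 hω n))
  -- Adding `n i` to the tail of `X` above `n i` gives a majorant of `X`, so each copy of the tail
  -- is within `n i` of a copy of `X`.
  have hY : ∀ i, ∃ Y : E.space, SameLaw (Y : Ω →ₘ[P] ℝ) (X : Ω →ₘ[P] ℝ) ∧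
      ∀ᵐ ω ∂P, |(Y : Ω →ₘ[P] ℝ) ω - (Z i : Ω →ₘ[P] ℝ) ω| ≤ n i := fun i => by
    obtain ⟨f, hf, hfZ⟩ := hP.exists_identDistrib_abs_sub_le (m := n i)
      (Z i : Ω →ₘ[P] ℝ).measurable ((sameLaw_cut_iff _).1 (hZ i))
      (X : Ω →ₘ[P] ℝ).aemeasurable
      (by
        filter_upwards [hX0] with ω hω
        exact indicator_apply_le' (fun _ => le_rfl) fun _ => hω)
      (Eventually.of_forall fun ω => by
        by_cases hω : (n i : ℝ) < (X : Ω →ₘ[P] ℝ) ω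
        · rw [indicator_of_mem (by exact hω)]
          simp
        · rw [indicator_of_notMem (by exact hω)]
          simpa using hω)
    obtain ⟨Y, hYf, hYX⟩ := exists_of_identDistrib hf
    refine ⟨Y, hYX, ?_⟩
    filter_upwards [hYf, hfZ] with ω h1 h2
    rwa [h1]
  choose Y hYX hYZ using hY
  have hV : ∑ i, c i • (Y i - Z i) ∈ E.orderContinuousPart := by
    refine mem_orderContinuousPart_of_bounded hP hE (c := ∑ i, c i * n i) ?_
    have hsub : ∀ i, ((Y i - Z i : E.space) : Ω →ₘ[P] ℝ) =ᵐ[P]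
        fun ω => (Y i : Ω →ₘ[P] ℝ) ω - (Z i : Ω →ₘ[P] ℝ) ω :=
      fun i => AEEqFun.coeFn_sub (Y i : Ω →ₘ[P] ℝ) (Z i)
    filter_upwards [coeFn_sum_smul Finset.univ c fun i => Y i - Z i, ae_all_iff.2 hYZ,
      ae_all_iff.2 hsub] with ω h1 h2 h3
    rw [h1, Finset.sum_apply]
    refine (Finset.abs_sum_le_sum_abs _ _).trans (Finset.sum_le_sum fun i _ => ?_)
    rw [Pi.smul_apply, smul_eq_mul, abs_mul, abs_of_nonneg (hc0 i), h3]
    exact mul_le_mul_of_nonneg_left (h2 i) (hc0 i)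
  have hmem : ∑ i, c i • Y i ∈ E.lawHull X :=
    mem_convexHull_of_exists_fintype c Y hc0 hc1 hYX rfl
  have := hb ⟨_, hmem, _, hV, rfl⟩
  have hsum : ∑ i, c i • Y i - ∑ i, c i • (Y i - Z i) = ∑ i, c i • Z i := by
    rw [← Finset.sum_sub_distrib]
    exact Finset.sum_congr rfl fun i _ => by module
  rw [hsum] at this
  exact absurd hlt (not_lt.2 this)

theorem AOCEA.convexAveraging (hP : IsNonAtomic P) (h : E.AOCEA) : E.ConvexAveraging := by
  intro X hX ε hε A hA hanti hempty
  have hX0 := ae_nonneg_of_nonneg hX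
  obtain ⟨_, ⟨Y, hY, V, hV, rfl⟩, hr⟩ := (isGLB_lt_iff (h X hX)).1 (half_pos hε)
  obtain ⟨ι, _, c, y, hc0, hc1, hyX, rfl⟩ := mem_convexHull_iff_exists_fintype.1 hY
  obtain ⟨δ, hδ, hVδ⟩ := mem_orderContinuousPart_iff.1 hV (ε / 2) (half_pos hε)
  -- A single index serves all summands: the union of `Fintype.card ι` sets of measure `P.real (A
  -- n)` then has measure below `δ`.
  obtain ⟨n, hn⟩ := (((tendsto_measureReal_of_antitone (P := P) hA hanti hempty).const_mul
    (Fintype.card ι : ℝ)).eventually (gt_mem_nhds (by simpa using hδ))).exists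
  choose f C hf hC hCA hfY using fun i => hP.exists_identDistrib_indicator_le
    (y i : Ω →ₘ[P] ℝ).measurable (X : Ω →ₘ[P] ℝ).measurable (hyX i) hX0 (hA n)
  choose Z hZf hZ using fun i => exists_of_identDistrib_indicator (hA n) (hf i)
  let e := Fintype.equivFin ι
  refine ⟨Fintype.card ι, fun _ => n, fun j => Z (e.symm j), fun j => c (e.symm j),
    fun j => hZ _, fun j => hc0 _, ?_, ?_⟩
  · rw [e.symm.sum_comp c, hc1]
  rw [e.symm.sum_comp fun i => c i • Z i]
  refine norm_lt_of_gauge_lt _ (coeFn_sum_smul _ _ _) ?_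
  let S := ⋃ i, C i
  have hS : MeasurableSet S := MeasurableSet.iUnion hC
  have hSδ : P.real S < δ := by
    refine lt_of_le_of_lt (measureReal_iUnion_fintype_le _) ?_
    simpa [hCA] using hn
  have hsplit : S.indicator ((∑ i, c i • y i : E.space) : Ω →ₘ[P] ℝ) =ᵐ[P]
      S.indicator ((∑ i, c i • y i - V : E.space) : Ω →ₘ[P] ℝ) +
        S.indicator (V : Ω →ₘ[P] ℝ) := by
    filter_upwards [AEEqFun.coeFn_sub ((∑ i, c i • y i : E.space) : Ω →ₘ[P] ℝ) V] with ω hω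
    by_cases hωS : ω ∈ S
    · simp only [Pi.add_apply, indicator_of_mem hωS]
      erw [hω]
      simp
    · simp [hωS]
  calc E.gauge (∑ i, c i • ((Z i : Ω →ₘ[P] ℝ) : Ω → ℝ))
      ≤ E.gauge (S.indicator ((∑ i, c i • y i : E.space) : Ω →ₘ[P] ℝ)) := by
        refine gauge_mono (Finset.aemeasurable_sum _ fun i _ =>
          (Z i : Ω →ₘ[P] ℝ).aemeasurable.const_smul _) ?_
        filter_upwards [ae_all_iff.2 hfY, ae_all_iff.2 hZf, coeFn_sum_smul Finset.univ c y]
          with ω h1 h2 h3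
        rw [Finset.sum_apply]
        have h4 : ∀ i, 0 ≤ (c i • ((Z i : Ω →ₘ[P] ℝ) : Ω → ℝ)) ω := fun i => by
          rw [Pi.smul_apply, h2]
          exact mul_nonneg (hc0 i) (h1 i).1
        rw [abs_of_nonneg (Finset.sum_nonneg fun i _ => h4 i)]
        by_cases hωS : ω ∈ S
        · rw [indicator_of_mem hωS, h3, Finset.sum_apply]
          refine (Finset.sum_le_sum fun i _ => ?_).trans (le_abs_self _)
          rw [Pi.smul_apply, Pi.smul_apply, h2]
          exact mul_le_mul_of_nonneg_left (h1 i).2.1 (hc0 i)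
        · rw [indicator_of_notMem hωS, abs_zero]
          refine (Finset.sum_eq_zero fun i _ => ?_).le
          have hi : ω ∉ C i := fun hi => hωS (mem_iUnion.2 ⟨i, hi⟩)
          rw [Pi.smul_apply, h2, (h1 i).2.2 hi, smul_zero]
    _ ≤ E.gauge (S.indicator ((∑ i, c i • y i - V : E.space) : Ω →ₘ[P] ℝ)) +
          E.gauge (S.indicator (V : Ω →ₘ[P] ℝ)) := by
        rw [gauge_congr hsplit]
        exact gauge_add _ _
    _ < ENNReal.ofReal (ε / 2) + ENNReal.ofReal (ε / 2) := by
        refine ENNReal.add_lt_add (lt_of_le_of_lt ?_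
          ((ENNReal.ofReal_lt_ofReal_iff (half_pos hε)).2 hr)) (hVδ S hS hSδ)
        rw [← gauge_coe]
        refine gauge_mono ((AEEqFun.measurable _).indicator hS).aemeasurable
          (Eventually.of_forall fun ω => ?_)
        by_cases hωS : ω ∈ S <;> simp [hωS]
    _ = ENNReal.ofReal ε := by
        rw [← ENNReal.ofReal_add (half_pos hε).le (half_pos hε).le, add_halves]

theorem DisjointAveraging.convexAveraging (hP : IsNonAtomic P) (h : E.DisjointAveraging) :
    E.ConvexAveraging := by
  intro X hX ε hε A hA hanti hempty
  -- Geometric bounds with total mass `1` leave room for disjoint copies of the whole subsequence.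
  have hsmall : ∀ j : ℕ, ∀ᶠ n in atTop, P (A n) < 2⁻¹ ^ (j + 1) := fun j => by
    have h := tendsto_measure_iInter_atTop (μ := P) (fun n => (hA n).nullMeasurableSet) hanti
      ⟨0, measure_ne_top _ _⟩
    rw [hempty, measure_empty] at h
    exact h.eventually (gt_mem_nhds (ENNReal.pow_pos (by simp) _))
  obtain ⟨φ, hφ, hφP⟩ := extraction_forall_of_eventually hsmall
  have hmass : ∑' j, P (A (φ j)) ≤ 1 := by
    refine (ENNReal.tsum_le_tsum fun j => (hφP j).le).trans (le_of_eq ?_)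
    rw [ENNReal.tsum_geometric_add_one, ENNReal.one_sub_inv_two, inv_inv]
    exact ENNReal.inv_mul_cancel (by simp) (by simp)
  have hXm : Measurable (X : Ω →ₘ[P] ℝ) := (X : Ω →ₘ[P] ℝ).measurable
  have hν : ∀ j S, MeasurableSet S → (P.restrict (A (φ j))).map (X : Ω →ₘ[P] ℝ) S =
      P ((X : Ω →ₘ[P] ℝ) ⁻¹' S ∩ A (φ j)) := fun j S hS => by
    rw [Measure.map_apply hXm hS, Measure.restrict_apply (hXm hS)]
  obtain ⟨B, G, hB, hG, hBd, hBG⟩ := hP.exists_disjoint_realization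
    (fun j => (P.restrict (A (φ j))).map (X : Ω →ₘ[P] ℝ))
    (by simpa [hν _ _ MeasurableSet.univ] using hmass)
  have hlaw : ∀ j, IdentDistrib ((B j).indicator G)
      ((A (φ j)).indicator (X : Ω →ₘ[P] ℝ)) P P := fun j => by
    refine identDistrib_of_measure_preimage_eq (hG.indicator (hB j)).aemeasurable
      (hXm.indicator (hA _)).aemeasurable fun S hS h0 => ?_
    have hpre : ∀ (A : Set Ω) (g : Ω → ℝ), A.indicator g ⁻¹' S = g ⁻¹' S ∩ A := fun A g => by
      ext ω
      by_cases hω : ω ∈ A <;> simp [hω, h0]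
    rw [hpre, hpre, inter_comm, hBG j S hS, hν j S hS]
  choose Z hZf hZ using fun j => exists_of_identDistrib_indicator (hA (φ j)) (hlaw j)
  obtain ⟨k, n, hk, hlt⟩ := h X ε hε (A ∘ φ) (fun j => hA (φ j)) (hanti.comp_monotone hφ.monotone)
    (by
      rw [← hempty]
      exact (hanti.iInter_comp_tendsto_atTop hφ.tendsto_atTop))
    hmass Z (fun i j hij => by
      filter_upwards [hZf i, hZf j] with ω h1 h2
      rw [h1, h2]
      exact indicator_eq_zero_or_of_disjoint (hBd hij) _ _ ω) hZ
  refine ⟨k, φ ∘ n, Z ∘ n, fun _ => 1 / (k : ℝ), fun i => hZ (n i), fun _ => by positivity, ?_, ?_⟩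
  · have : (k : ℝ) ≠ 0 := by exact_mod_cast hk.ne'
    simp [this]
  · rwa [← Finset.smul_sum]

/-- Convex averaging implies disjoint averaging with distinct indices, in every r.i. space: neither
monotone completeness nor order continuity is needed, by `gauge_disjoint_sum_le`. -/
theorem ConvexAveraging.disjointAveragingDistinct (hP : IsNonAtomic P) (h : E.ConvexAveraging) :
    E.DisjointAveragingDistinct := by
  intro X ε hε A hA hanti hempty _ D hD hDlaw
  have hXm : Measurable (X : Ω →ₘ[P] ℝ) := (X : Ω →ₘ[P] ℝ).measurable
  obtain ⟨habs, -⟩ := E.solid X |(X : Ω →ₘ[P] ℝ)| (by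
    rw [← AEEqFun.coeFn_le]
    filter_upwards [AEEqFun.coeFn_abs |(X : Ω →ₘ[P] ℝ)|, AEEqFun.coeFn_abs (X : Ω →ₘ[P] ℝ)]
      with ω h1 h2
    rw [h1, h2, abs_abs])
  let X' : E.space := ⟨|(X : Ω →ₘ[P] ℝ)|, habs⟩
  have hX' : (X' : Ω →ₘ[P] ℝ) =ᵐ[P] fun ω => |(X : Ω →ₘ[P] ℝ) ω| := AEEqFun.coeFn_abs _
  obtain ⟨k, n, Z, c, hZ, hc0, hc1, hlt⟩ := h X' (by
    rw [← AEEqFun.coeFn_le]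
    filter_upwards [hX', AEEqFun.coeFn_zero (μ := P) (β := ℝ)] with ω h1 h2
    rw [h1, h2]
    exact abs_nonneg _) ε hε A hA hanti hempty
  set g := E.norm (∑ i, c i • Z i) with hg
  have hZ' : ∀ i, IdentDistrib (Z i : Ω →ₘ[P] ℝ)
      ((A (n i)).indicator fun ω => |(X : Ω →ₘ[P] ℝ) ω|) P P := fun i =>
    ((sameLaw_cut_iff _).1 (hZ i)).trans
      (IdentDistrib.of_ae_eq ((X' : Ω →ₘ[P] ℝ).measurable.indicator (hA _)).aemeasurable
        hX'.indicator)
  -- equal weights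
  obtain ⟨M, hM⟩ := exists_nat_gt (ε * k / (ε - g))
  rw [div_lt_iff₀ (sub_pos.2 hlt)] at hM
  -- Rounding down loses at most one copy per index, so `N ≥ M - k`; `M` was chosen to make this
  -- enough for `M * g < ε * N`.
  let r : Fin k → ℕ := fun i => ⌊M * c i⌋₊
  let N := Fintype.card (Σ i, Fin (r i))
  let e : Fin N ≃ Σ i, Fin (r i) := (Fintype.equivFin _).symm
  have hNr : (N : ℝ) = ∑ i, (r i : ℝ) := by simp [N]
  have hNM : (M : ℝ) - k ≤ N := by
    have h1 : ∀ i ∈ Finset.univ, M * c i - 1 ≤ (r i : ℝ) := fun i _ => (Nat.sub_one_lt_floor _).le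
    have h2 := Finset.sum_le_sum h1
    rw [Finset.sum_sub_distrib, ← Finset.mul_sum, hc1] at h2
    rw [hNr]
    simpa using h2
  have hMN : M * g < ε * N := by
    have := mul_le_mul_of_nonneg_left hNM hε.le
    linarith
  have hN0 : 0 < N := by
    have h1 : 0 ≤ M * g := mul_nonneg M.cast_nonneg (apply_nonneg _ _)
    have h2 : (0 : ℝ) < N := (mul_pos_iff_of_pos_left hε).1 (h1.trans_lt hMN)
    exact_mod_cast h2
  -- The shift by `∑ i, n i` puts every new index beyond all the `n i`; as `A` decreases, the new
  -- truncations lie below the old ones.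
  let m : Fin N → ℕ := fun j => j + ∑ i, n i
  have hm : Function.Injective m := fun i j hij => Fin.ext (Nat.add_right_cancel hij)
  have hnm : ∀ j, n (e j).1 ≤ m j := fun j =>
    (Finset.single_le_sum (f := n) (fun _ _ => Nat.zero_le _) (Finset.mem_univ _)).trans
      (Nat.le_add_left _ _)
  have hind : ∀ a, AEMeasurable ((A a).indicator fun ω => |(X : Ω →ₘ[P] ℝ) ω|) P := fun a =>
    (hXm.abs.indicator (hA a)).aemeasurable
  have hind0 : ∀ a ω, 0 ≤ (A a).indicator (fun ω => |(X : Ω →ₘ[P] ℝ) ω|) ω := fun a ω =>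
    indicator_nonneg (fun _ _ => abs_nonneg _) ω
  choose f hfm hf hfZ using fun j : Fin N => hP.exists_identDistrib_le
    (Z (e j).1 : Ω →ₘ[P] ℝ).measurable (hZ' (e j).1) (hind (m j))
    (Eventually.of_forall (hind0 (m j))) (Eventually.of_forall fun ω =>
      indicator_le_indicator_of_subset (hanti (hnm j)) (fun _ => abs_nonneg _) ω)
  have hZ0 : ∀ i, ∀ᵐ ω ∂P, 0 ≤ (Z i : Ω →ₘ[P] ℝ) ω := fun i =>
    (hZ' i).symm.ae_snd (p := fun x => 0 ≤ x) measurableSet_Ici (Eventually.of_forall (hind0 _))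
  have hfsum : E.gauge (∑ j, fun ω => (f j ω : ℝ)) ≤ ENNReal.ofReal (M * g) := by
    calc E.gauge (∑ j, fun ω => (f j ω : ℝ))
        ≤ E.gauge ((M : ℝ) • ∑ i, c i • ((Z i : Ω →ₘ[P] ℝ) : Ω → ℝ)) := by
          refine gauge_mono (Finset.aemeasurable_sum _ fun j _ =>
            (hfm j).coe_nnreal_real.aemeasurable) ?_
          filter_upwards [ae_all_iff.2 hfZ, ae_all_iff.2 hZ0] with ω h1 h2
          rw [Finset.sum_apply, abs_of_nonneg (Finset.sum_nonneg fun j _ => NNReal.coe_nonneg _)]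
          refine le_trans ?_ (le_abs_self _)
          calc ∑ j, (f j ω : ℝ) ≤ ∑ j, (Z (e j).1 : Ω →ₘ[P] ℝ) ω :=
                Finset.sum_le_sum fun j _ => h1 j
            _ = ∑ x : Σ i, Fin (r i), (Z x.1 : Ω →ₘ[P] ℝ) ω :=
                e.sum_comp fun x => (Z x.1 : Ω →ₘ[P] ℝ) ω
            _ = ∑ i, (r i : ℝ) * (Z i : Ω →ₘ[P] ℝ) ω := by
                rw [Fintype.sum_sigma]
                simp
            _ ≤ ∑ i, (M * c i) * (Z i : Ω →ₘ[P] ℝ) ω := by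
                refine Finset.sum_le_sum fun i _ => mul_le_mul_of_nonneg_right ?_ (h2 i)
                exact Nat.floor_le (mul_nonneg M.cast_nonneg (hc0 i))
            _ = _ := by
                simp only [Pi.smul_apply, Finset.sum_apply, smul_eq_mul, Finset.mul_sum, mul_assoc]
      _ = ENNReal.ofReal (M * g) := by
          rw [gauge_smul, ← gauge_congr (coeFn_sum_smul Finset.univ c Z), gauge_coe,
            ← ENNReal.ofReal_mul (abs_nonneg _), Nat.abs_cast]
  have hDf : ∀ j, IdentDistrib (fun ω => |(D (m j) : Ω →ₘ[P] ℝ) ω|) (fun ω => (f j ω : ℝ)) P P :=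
    fun j => by
      have h1 := ((sameLaw_cut_iff _).1 (hDlaw (m j))).comp measurable_norm
      have h2 : Norm.norm ∘ (A (m j)).indicator (X : Ω →ₘ[P] ℝ) =
          (A (m j)).indicator fun ω => |(X : Ω →ₘ[P] ℝ) ω| := by
        ext ω
        by_cases hω : ω ∈ A (m j) <;> simp [hω]
      rw [h2] at h1
      exact h1.trans (hf j).symm
  have hdis := gauge_disjoint_sum_le (E := E) hP hfm
    (D := fun j => (D (m j) : Ω →ₘ[P] ℝ)) (fun i j hij => hD _ _ (hm.ne hij)) hDf
    (fun j => (D (m j) : Ω →ₘ[P] ℝ).aemeasurable)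
  have hN0' : (0 : ℝ) < N := by exact_mod_cast hN0
  refine ⟨N, m, hN0, hm, ?_⟩
  have hcoe : ((∑ j, D (m j) : E.space) : Ω →ₘ[P] ℝ) =ᵐ[P]
      ∑ j, ((D (m j) : Ω →ₘ[P] ℝ) : Ω → ℝ) := by
    simpa using coeFn_sum_smul Finset.univ (fun _ => (1 : ℝ)) fun j => D (m j)
  have hnorm : E.norm (∑ j, D (m j)) < ε * N :=
    norm_lt_of_gauge_lt _ hcoe ((hdis.trans hfsum).trans_lt
      ((ENNReal.ofReal_lt_ofReal_iff (mul_pos hε hN0')).2 hMN))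
  rw [map_smul_eq_mul, Real.norm_eq_abs, abs_of_pos (one_div_pos.2 hN0'), one_div,
    inv_mul_lt_iff₀ hN0', mul_comm]
  exact hnorm

end RISpace

theorem proposition3p2 {Ω : Type*} [MeasurableSpace Ω] (P : Measure Ω) [IsProbabilityMeasure P]
    (hP : IsNonAtomic P) (E : RISpace P) (hE : E.space.toAddSubgroup ≠ Lp ℝ ∞ P) :
    (E.DisjointAveraging → E.ConvexAveraging) ∧
    (E.ConvexAveraging ↔ E.AOCEA) ∧
    (E.IsMonotonicallyComplete ∨ E.IsOrderContinuous →
      E.ConvexAveraging → E.DisjointAveragingDistinct) :=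
  ⟨fun h => h.convexAveraging hP, ⟨fun h => h.aocea hP hE, fun h => h.convexAveraging hP⟩,
    fun _ h => h.disjointAveragingDistinct hP⟩
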